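/- Let $K$ be a finite set and ${\sf P}=({\sf P}(i,j))_{i,j\in K}$ the transition matrix of an irreducible lazy Markov chain on $K$, not necessarily reversible (lazy: ${\sf P}(i,i)\ge\frac12$ for all $i$). Let $\pi$ be its stationary distribution, $\pi(A)=\sum_{v\in A}\pi(v)$, $\pi_0=\min_{v\in K}\pi(v)$, $q(x,y)=\pi(x){\sf P}(x,y)$ and $\overleftarrow{\sf P}(u,v)=\pi(v){\sf P}(v,u)/\pi(u)$. *Continuization.* Write $[0,1]$ as a union of closed intervals $I_v$ ($v\in K$) of lengths $\pi(v)$ with pairwise overlaps of Lebesgue measure zero. Identify $A\subseteq K$ with $\bigcup_{v\in A}I_v$. For measurable $S,T\subseteq[0,1]$ let $\pi(S)=m(S)$ be Lebesgue measure and ${\sf Q}(S,T)=\sum_{x,y\in K}\frac{m(S\cap I_x)}{\pi(x)}\frac{m(T\cap I_y)}{\pi(y)}q(x,y)$. *Set quantities.* For $\emptyset\ne A\subseteq K$ and $A^c=K\setminus A$, let $$\overleftarrow\Psi(t,A^c)=\begin{cases}\inf\{{\sf Q}(A^c,B): B\subseteq A \text{ measurable in }[0,1],\ \pi(B)=t\},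 & 0\le t\le\pi(A),\\ \inf\{{\sf Q}(A,B): B\subseteq A^c\text{ measurable in }[0,1],\ \pi(B)=1-t\}, & \pi(A)<t\le1,\end{cases}$$ $$\overleftarrow\psi^+(A)=\int_0^{\pi(A)}\frac{\overleftarrow\Psi(t,A^c)}{\pi(A)^2}\,dt,\qquad \overleftarrow\psi_{gl}(A)=\int_0^1\frac{\overleftarrow\Psi(t,A^c)}{\pi(A)^2}\,dt,\qquad \overleftarrow\psi_{mod}(A)=\int_0^1\frac{\overleftarrow\Psi(t,A^c)}{\pi(A)\min\{t,1-t\}}\,dt,$$ $$\psi_{evo}(A)=1-\int_0^1\sqrt{\frac{\pi(A_u)}{\pi(A)}}\,du,\qquad A_u=\Big\{y\in K:\ \sum_{x\in A}\overleftarrow{\sf P}(y,x)>u\Big\},$$ and let $\overleftarrow\psi^+(x)=\inf\{\overleftarrow\psi^+(A):\ \emptyset\ne A\subseteq K,\ \pi(A)\le x\}$. *Mixing times.* For a probability vector $p$ on $K$ let $\|p-\pi\|_{TV}=\frac12\sum_v\big|\frac{p(v)}{\pi(v)}-1\big|\pi(v)$ and $\|p-\pi\|_{\chi^2(\pi)}=\sum_v\big|\frac{p(v)}{\pi(v)}-1\big|^2\pi(v)$.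 Let $\tau(\epsilon)$, respectively $\chi^2(\epsilon)$, be the maximum over all initial distributions $p$ of the least integer $t\ge0$ with $\|p\,{\sf P}^t-\pi\|_{TV}\le\epsilon$, respectively $\|p\,{\sf P}^t-\pi\|_{\chi^2(\pi)}\le\epsilon$. **Theorem.** (i) For every nonempty $A\subseteq K$ with $\pi(A)\le\frac12$, $$\overleftarrow\psi_{gl}(A)\ \ge\ \tfrac12\,\overleftarrow\psi_{mod}(A)\ \ge\ \psi_{evo}(A)\ \ge\ \tfrac14\,\overleftarrow\psi^+(A).$$ (ii) For every $0<\epsilon<1$, $$\tau(\epsilon)\ \le\ \chi^2(4\epsilon^2)\ \le\ 4\int_{\pi_0}^{1/2}\frac{dx}{x\,\overleftarrow\psi^+(x)}+\frac{4\log(2/\epsilon^2)}{\overleftarrow\psi^+(1/2)},$$ and if moreover $4\epsilon^2\pi_0\le1$ (which always holds when $\epsilon\le\frac12$), then also $$\chi^2(4\epsilon^2)\ \le\ \frac{2}{\overleftarrow\psi^+(1/2)}\Big(\log\frac1{\pi_0}+2\log\frac1{2\epsilon}\Big).$$ (If $K$ is a single state, all the mixing times are $0$ and the right-hand sides are read as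 $0$.) -/

import Mathlib

open MeasureTheory
open scoped Matrix ENNReal

noncomputable section

namespace Spread

variable {K : Type*} [Fintype K]

/-- An irreducible finite Markov chain with transition matrix `P`: nonnegative entries,
rows summing to one, and every state reachable from every state. -/
structure IsMarkovChain [DecidableEq K] (P : Matrix K K ℝ) : Prop where
  nonneg : ∀ i j, 0 ≤ P i j
  row_sum : ∀ i, ∑ j, P i j = 1
  irreducible : ∀ i j, ∃ t : ℕ, 0 < (P ^ t) i j

/-- A chain is lazy if it holds with probability at least one half at every state. -/
def IsLazy (P : Matrix K K ℝ) : Prop := ∀ i, 1 / 2 ≤ P i i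

/-- `π` is a stationary probability distribution of `P`. -/
structure IsStationary (P : Matrix K K ℝ) (π : K → ℝ) : Prop where
  mem_stdSimplex : π ∈ stdSimplex ℝ K
  stationary : π ᵥ* P = π

/-- The mass `π(A)` of a set of states. -/
def mass (π : K → ℝ) (A : Finset K) : ℝ := ∑ v ∈ A, π v

/-- `π₀`, the smallest stationary probability of a state. -/
def minMass (π : K → ℝ) : ℝ := ⨅ v, π v

/-- The time reversal, with transition probabilities `π(v) P(v,u) / π(u)`. -/
def reversal (P : Matrix K K ℝ) (π : K → ℝ) : Matrix K K ℝ :=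
  fun u v => π v * P v u / π u

/-- The ergodic flow `q(x,y) = π(x) P(x,y)` between two states. -/
def flow (P : Matrix K K ℝ) (π : K → ℝ) (x y : K) : ℝ := π x * P x y

/-! ### Distances and mixing times -/

/-- Total variation distance, half of the `L¹(π)` distance of the density from one. -/
def tvDist (p π : K → ℝ) : ℝ := 1 / 2 * ∑ v, |p v / π v - 1| * π v

/-- The `χ²(π)` distance, the square of the `L²(π)` distance of the density from one. -/
def chiSqDist (p π : K → ℝ) : ℝ := ∑ v, |p v / π v - 1| ^ 2 * π v

/-- The worst case, over initial distributions `p`, of the first time at which `p Pᵗ` is within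
`ε` of `π` in the distance `d`; it is `⊤` if that time is infinite or unbounded. -/
def worstTime [DecidableEq K] (d : (K → ℝ) → (K → ℝ) → ℝ) (P : Matrix K K ℝ) (π : K → ℝ)
    (ε : ℝ) : ℕ∞ :=
  ⨆ p ∈ stdSimplex ℝ K, ⨅ t ∈ {t : ℕ | d (p ᵥ* P ^ t) π ≤ ε}, (t : ℕ∞)

/-- The total variation mixing time `τ(ε)`. -/
def tvMixingTime [DecidableEq K] (P : Matrix K K ℝ) (π : K → ℝ) (ε : ℝ) : ℕ∞ :=
  worstTime tvDist P π ε

/-- The chi-square mixing time `χ²(ε)`. -/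
def chiSqMixingTime [DecidableEq K] (P : Matrix K K ℝ) (π : K → ℝ) (ε : ℝ) : ℕ∞ :=
  worstTime chiSqDist P π ε

/-! ### The continuization of the state space -/

/-- A continuization of the state space: `[0,1]` is the union of closed intervals `I_v` of length
`π(v)`, one for each state, which pairwise overlap in null sets only. -/
structure Continuization (π : K → ℝ) where
  left : K → ℝ
  iUnion_eq : ⋃ v, Set.Icc (left v) (left v + π v) = Set.Icc (0 : ℝ) 1
  overlap : ∀ x y, x ≠ y →
    volume (Set.Icc (left x) (left x + π x) ∩ Set.Icc (left y) (left y + π y)) = 0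

namespace Continuization

variable {π : K → ℝ} (C : Continuization π)

/-- The interval `I_v`. -/
def block (v : K) : Set ℝ := Set.Icc (C.left v) (C.left v + π v)

/-- The subset of `[0,1]` that corresponds to a set of states. -/
def lift (A : Finset K) : Set ℝ := ⋃ v ∈ A, C.block v

/-- The ergodic flow `Q(S,T)` between two subsets of the continuization. -/
def Q (P : Matrix K K ℝ) (S T : Set ℝ) : ℝ :=
  ∑ x, ∑ y, volume.real (S ∩ C.block x) / π x * (volume.real (T ∩ C.block y) / π y) *
    flow P π x y

variable [DecidableEq K]

/-- The infimum of `Q(Aᶜ,B)` over the subsets `B` of `A` of measure `t` in the continuization. -/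
def minFlow (P : Matrix K K ℝ) (t : ℝ) (A : Finset K) : ℝ :=
  sInf {r | ∃ B : Set ℝ, MeasurableSet B ∧ B ⊆ C.lift A ∧ volume.real B = t ∧
    r = C.Q P (C.lift Aᶜ) B}

/-- The time-reversed profile `t ↦ Ψ(t,Aᶜ)`: it is the infimum of `Q(Aᶜ,B)` over `B ⊆ A` with
`π(B) = t` if `t ≤ π(A)`, and the infimum of `Q(A,B)` over `B ⊆ Aᶜ` with `π(B) = 1 - t`
if `t > π(A)`. -/
def revPsi (P : Matrix K K ℝ) (t : ℝ) (A : Finset K) : ℝ :=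
  if t ≤ mass π A then C.minFlow P t A else C.minFlow P (1 - t) Aᶜ

/-- The time-reversed spread of a set. -/
def spread (P : Matrix K K ℝ) (A : Finset K) : ℝ :=
  ∫ t in (0 : ℝ)..mass π A, C.revPsi P t A / mass π A ^ 2

/-- The time-reversed modified spread of a set. -/
def modSpread (P : Matrix K K ℝ) (A : Finset K) : ℝ :=
  ∫ t in (0 : ℝ)..1, C.revPsi P t A / (mass π A * min t (1 - t))

/-- The time-reversed global spread of a set. -/
def glSpread (P : Matrix K K ℝ) (A : Finset K) : ℝ :=
  ∫ t in (0 : ℝ)..1, C.revPsi P t A / mass π A ^ 2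

/-- The time-reversed spread profile: the infimum of the spread over the nonempty sets of states of
mass at most `x`. -/
def spreadProfile (P : Matrix K K ℝ) (x : ℝ) : ℝ :=
  sInf {r | ∃ A : Finset K, A.Nonempty ∧ mass π A ≤ x ∧ r = C.spread P A}

end Continuization

/-! ### Evolving sets -/

open Classical in
/-- The level set `A_u` of the states from which the reversed chain enters `A` with probability
larger than `u`. -/
def levelSet (P : Matrix K K ℝ) (π : K → ℝ) (A : Finset K) (u : ℝ) : Finset K :=
  Finset.univ.filter fun y => u < ∑ x ∈ A, reversal P π y x

/-- The evolving-set quantity of a set. -/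
def evoSpread (P : Matrix K K ℝ) (π : K → ℝ) (A : Finset K) : ℝ :=
  1 - ∫ u in (0 : ℝ)..1, √(mass π (levelSet P π A u) / mass π A)

/-! ### Continuizations exist -/

theorem nonempty_continuization (π : K → ℝ) (hπ : π ∈ stdSimplex ℝ K) :
    Nonempty (Continuization π) := by
  classical
  obtain ⟨h0, h1⟩ := hπ
  let e := Fintype.equivFin K
  let l : K → ℝ := fun v => ∑ w ∈ Finset.univ.filter (fun w => e w < e v), π w
  have hstep : ∀ v, l v + π v = ∑ w ∈ Finset.univ.filter (fun w => e w ≤ e v), π w := by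
    intro v
    have : Finset.univ.filter (fun w => e w ≤ e v)
        = insert v (Finset.univ.filter (fun w => e w < e v)) := by
      ext w
      simp only [Finset.mem_filter, Finset.mem_univ, true_and, Finset.mem_insert]
      rw [le_iff_eq_or_lt, e.injective.eq_iff]
    rw [this, Finset.sum_insert (by simp), add_comm]
  have hl0 : ∀ v, 0 ≤ l v := fun v => Finset.sum_nonneg fun w _ => h0 w
  have hl1 : ∀ v, l v + π v ≤ 1 := by
    intro v
    rw [hstep, ← h1]
    exact Finset.sum_le_sum_of_subset_of_nonneg (Finset.filter_subset _ _) fun w _ _ => h0 w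
  have hlt : ∀ x y, e x < e y → l x + π x ≤ l y := by
    intro x y hxy
    rw [hstep]
    refine Finset.sum_le_sum_of_subset_of_nonneg ?_ fun w _ _ => h0 w
    intro w hw
    simp only [Finset.mem_filter, Finset.mem_univ, true_and] at hw ⊢
    exact lt_of_le_of_lt hw hxy
  have hover : ∀ x y, e x < e y →
      volume (Set.Icc (l x) (l x + π x) ∩ Set.Icc (l y) (l y + π y)) = 0 := by
    intro x y hxy
    refine measure_mono_null (t := {l y}) ?_ (by simp)
    rintro z ⟨hz1, hz2⟩
    exact le_antisymm (hz1.2.trans (hlt x y hxy)) hz2.1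
  refine ⟨⟨l, ?_, ?_⟩⟩
  · apply Set.Subset.antisymm
    · refine Set.iUnion_subset fun v z hz => ⟨(hl0 v).trans hz.1, hz.2.trans (hl1 v)⟩
    · intro z hz
      by_cases hK : ∃ v, l v ≤ z
      · obtain ⟨v, hv, hmax⟩ := Finset.exists_max_image
          (Finset.univ.filter fun v => l v ≤ z) (fun v => e v)
          (hK.imp fun v hv => by simpa using hv)
        simp only [Finset.mem_filter, Finset.mem_univ, true_and] at hv hmax
        refine Set.mem_iUnion.2 ⟨v, hv, ?_⟩
        by_contra! hcon
        by_cases hlast : (e v : ℕ) + 1 < Fintype.card K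
        · have hw := hmax (e.symm ⟨e v + 1, hlast⟩) (by
            have : l (e.symm ⟨e v + 1, hlast⟩) = l v + π v := by
              rw [hstep]
              refine Finset.sum_congr ?_ (fun _ _ => rfl)
              ext w
              simp only [Finset.mem_filter, Finset.mem_univ, true_and, Equiv.apply_symm_apply,
                Fin.lt_def, Fin.le_def]
              omega
            rw [this]; exact hcon.le)
          simp [Fin.le_def] at hw
        · have : l v + π v = 1 := by
            rw [hstep, ← h1]
            refine Finset.sum_congr ?_ (fun _ _ => rfl)
            ext w
            have hle : e w ≤ e v := by
              have := (e w).2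
              rw [Fin.le_def]
              omega
            simp only [Finset.mem_filter, Finset.mem_univ, true_and, iff_true]
            exact hle
          linarith [hz.2]
      · exfalso
        have hne : Nonempty K := by
          by_contra hne
          rw [not_nonempty_iff] at hne
          simp at h1
        have hpos : 0 < Fintype.card K := Fintype.card_pos
        apply hK
        refine ⟨e.symm ⟨0, hpos⟩, ?_⟩
        have : l (e.symm ⟨0, hpos⟩) = 0 := by
          apply Finset.sum_eq_zero
          intro w hw
          simp at hw
        rw [this]; exact hz.1
  · intro x y hxy
    rcases lt_or_gt_of_ne (fun h => hxy (e.injective h)) with h | h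
    · exact hover x y h
    · rw [Set.inter_comm]; exact hover y x h

end Spread

end

/-! Everything reduces to the function `u ↦ π(A_u)` on `[0,1]`. Laziness gives `A ⊆ A_u` for `u <
1/2` and `A_u ⊆ A` for `u ≥ 1/2`. A greedy choice of `B` solves the minimisation in `Ψ` at all
levels at once (`minFlow_eq`): `Ψ(t,Aᶜ)` is the integral of `(t - π(A_u))⁺` over `[1/2,1]` if `t ≤
π(A)`, and of `(π(A_u) - t)⁺` over `[0,1/2]` otherwise. Integrating in `t` turns the set quantities
into level integrals of functions of `x = π(A_u)/π(A)`. Since `x` has mean one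
(`integral_mass_levelSet`), multiples of `x - 1` are free, and (i) follows from one-variable
inequalities: `1 - √x` lies between `(1 - x)²/8` (on `x ≤ 1`) and `(x log x - x + 1)/2` modulo such
terms, and a Chebyshev-type argument compares the two weights in `t`.

For (ii), the sets `A_u` with uniform `u` are the steps of the evolving set process. Started from
`{x}`, the probability that `y` belongs to the `n`-th set is `π(x) Pⁿ(x,y)/π(y)`, so by Minkowski
the chi-square distance is controlled by the expectation of the norm `√(π(S)(1 - π(S)))`
(`chiSqDist_le`). This norm contracts in one step by `1 - ψ_evo(S)` (`integral_spreadNorm_le`) and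
is invariant under complements, so only the profile up to one half is needed
(`integral_spreadNorm_le_profile`).

The logarithmic bound iterates the worst rate. The integral bound follows `v = 4/l²`, where `l` is
the expected norm divided by `π(x)`: sets larger than `v` contribute at most half of the
expectation, so `v` grows by the factor `exp(ψ⁺(v)/4)` per step, and each step uses at least one
unit of `∫ 4 dx/(x ψ⁺(x))`. In both bounds the time is a floor, and the step lost to rounding is
recovered at the start of the process. -/

namespace Spread

/-! ### Elementary facts on the chain and its level sets -/

section Basic

variable {K : Type*} [Fintype K]

/-- The probability that the reversed chain enters `A` from `y`. -/
noncomputable def entry (P : Matrix K K ℝ) (π : K → ℝ) (A : Finset K) (y : K) : ℝ :=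
  ∑ x ∈ A, reversal P π y x

theorem mem_levelSet {P : Matrix K K ℝ} {π : K → ℝ} {A : Finset K} {u : ℝ} {y : K} :
    y ∈ levelSet P π A u ↔ u < entry P π A y := by
  simp [levelSet, entry]

theorem measurableSet_levelSet_eq (P : Matrix K K ℝ) (π : K → ℝ) (A S : Finset K) :
    MeasurableSet {u | levelSet P π A u = S} := by
  have : {u | levelSet P π A u = S} = ⋂ y, {u | u < entry P π A y ↔ y ∈ S} := by
    ext u
    simp [Finset.ext_iff, mem_levelSet]
  rw [this]
  refine MeasurableSet.iInter fun y => ?_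
  by_cases hy : y ∈ S
  · simp only [hy, iff_true]
    exact measurableSet_Iio
  · simp only [hy, iff_false, not_lt]
    exact measurableSet_Ici

/-- The Lebesgue measure of the levels `u` between `a` and `b` with level set `S`. -/
noncomputable def levelWeight (P : Matrix K K ℝ) (π : K → ℝ) (A : Finset K) (a b : ℝ) (S : Finset K) : ℝ :=
  ∫ u in a..b, Set.indicator {u | levelSet P π A u = S} (fun _ => (1 : ℝ)) u

-- The level set takes finitely many values, each on a measurable set of levels. Integrals over
-- levels are therefore finite sums, and exchanging them with an integral in `t` needs only
-- linearity.
open Classical in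
theorem comp_levelSet_eq_sum (P : Matrix K K ℝ) (π : K → ℝ) (A : Finset K) (φ : Finset K → ℝ)
    (u : ℝ) : φ (levelSet P π A u) =
      ∑ S, Set.indicator {u | levelSet P π A u = S} (fun _ => (1 : ℝ)) u * φ S := by
  simp [Set.indicator_apply]

theorem intervalIntegrable_levelIndicator (P : Matrix K K ℝ) (π : K → ℝ) (A S : Finset K)
    (a b : ℝ) : IntervalIntegrable
      (Set.indicator {u | levelSet P π A u = S} (fun _ => (1 : ℝ))) volume a b := by
  have h : IntervalIntegrable (fun _ : ℝ => (1 : ℝ)) volume a b := intervalIntegrable_const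
  exact ⟨h.1.indicator (measurableSet_levelSet_eq P π A S),
    h.2.indicator (measurableSet_levelSet_eq P π A S)⟩

theorem intervalIntegrable_fun_sum {ι : Type*} [Fintype ι] {f : ι → ℝ → ℝ} {a b : ℝ}
    (h : ∀ i, IntervalIntegrable (f i) volume a b) :
    IntervalIntegrable (fun u => ∑ i, f i u) volume a b := by
  simpa only [Finset.sum_fn] using IntervalIntegrable.sum Finset.univ fun i _ => h i

theorem intervalIntegrable_comp_levelSet (P : Matrix K K ℝ) (π : K → ℝ) (A : Finset K)
    (φ : Finset K → ℝ) (a b : ℝ) :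
    IntervalIntegrable (fun u => φ (levelSet P π A u)) volume a b := by
  simp_rw [comp_levelSet_eq_sum P π A φ]
  exact intervalIntegrable_fun_sum fun S =>
    (intervalIntegrable_levelIndicator P π A S a b).mul_const _

theorem integral_comp_levelSet (P : Matrix K K ℝ) (π : K → ℝ) (A : Finset K)
    (φ : Finset K → ℝ) (a b : ℝ) :
    ∫ u in a..b, φ (levelSet P π A u) = ∑ S, levelWeight P π A a b S * φ S := by
  simp_rw [comp_levelSet_eq_sum P π A φ]
  rw [intervalIntegral.integral_finsetSum fun S _ =>
    (intervalIntegrable_levelIndicator P π A S a b).mul_const _]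
  simp_rw [intervalIntegral.integral_mul_const]
  rfl

theorem levelWeight_nonneg (P : Matrix K K ℝ) (π : K → ℝ) (A S : Finset K) {a b : ℝ}
    (hab : a ≤ b) : 0 ≤ levelWeight P π A a b S :=
  intervalIntegral.integral_nonneg hab fun _ _ => Set.indicator_nonneg (fun _ _ => zero_le_one) _

/-- Integration over levels commutes with integration over a parameter. -/
theorem integral_integral_comp_levelSet (P : Matrix K K ℝ) (π : K → ℝ) (A : Finset K)
    (f : ℝ → Finset K → ℝ) (a b c d : ℝ)
    (hf : ∀ S, IntervalIntegrable (fun t => f t S) volume c d) :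
    ∫ t in c..d, ∫ u in a..b, f t (levelSet P π A u) =
      ∫ u in a..b, ∫ t in c..d, f t (levelSet P π A u) := by
  rw [integral_comp_levelSet P π A (fun S => ∫ t in c..d, f t S)]
  simp_rw [fun t => integral_comp_levelSet P π A (f t) a b]
  rw [intervalIntegral.integral_finsetSum fun S _ => (hf S).const_mul _]
  simp_rw [intervalIntegral.integral_const_mul]

theorem intervalIntegrable_integral_comp_levelSet (P : Matrix K K ℝ) (π : K → ℝ) (A : Finset K)
    (f : ℝ → Finset K → ℝ) (a b c d : ℝ)
    (hf : ∀ S, IntervalIntegrable (fun t => f t S) volume c d) :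
    IntervalIntegrable (fun t => ∫ u in a..b, f t (levelSet P π A u)) volume c d := by
  simp_rw [fun t => integral_comp_levelSet P π A (f t) a b]
  exact intervalIntegrable_fun_sum fun S => (hf S).const_mul _

theorem IsStationary.sum_eq {P : Matrix K K ℝ} {π : K → ℝ} (hπ : IsStationary P π) (y : K) :
    ∑ x, π x * P x y = π y := by
  simpa [Matrix.vecMul, dotProduct] using congrFun hπ.stationary y

theorem IsStationary.vecMul_pow [DecidableEq K] {P : Matrix K K ℝ} {π : K → ℝ}
    (hπ : IsStationary P π) (t : ℕ) : π ᵥ* P ^ t = π := by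
  induction t with
  | zero => simp
  | succ t ih => rw [pow_succ, ← Matrix.vecMul_vecMul, ih, hπ.stationary]

theorem IsMarkovChain.pow_nonneg [DecidableEq K] {P : Matrix K K ℝ} (hP : IsMarkovChain P)
    (t : ℕ) (i j : K) : 0 ≤ (P ^ t) i j := by
  induction t generalizing j with
  | zero => rw [pow_zero, Matrix.one_apply]; split_ifs <;> norm_num
  | succ t ih =>
    rw [pow_succ, Matrix.mul_apply]
    exact Finset.sum_nonneg fun k _ => mul_nonneg (ih k) (hP.nonneg k j)

/-- Some state carries mass, and irreducibility transports it to every state through `π Pᵗ = π`. -/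
theorem IsStationary.pos [DecidableEq K] {P : Matrix K K ℝ} {π : K → ℝ}
    (hπ : IsStationary P π) (hP : IsMarkovChain P) (y : K) : 0 < π y := by
  obtain ⟨h0, h1⟩ := hπ.mem_stdSimplex
  obtain ⟨x, -, hx⟩ : ∃ x ∈ Finset.univ, 0 < π x := by
    apply Finset.exists_lt_of_sum_lt
    simp [h1]
  obtain ⟨t, ht⟩ := hP.irreducible x y
  have h := congrFun (hπ.vecMul_pow t) y
  simp only [Matrix.vecMul, dotProduct] at h
  rw [← h]
  refine lt_of_lt_of_le (mul_pos hx ht)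
    (Finset.single_le_sum (f := fun i => π i * (P ^ t) i y) (fun i _ => ?_) (Finset.mem_univ x))
  exact mul_nonneg (h0 i) (hP.pow_nonneg t i y)

theorem mass_le_one {P : Matrix K K ℝ} {π : K → ℝ} (hπ : IsStationary P π) (A : Finset K) :
    mass π A ≤ 1 := by
  rw [← hπ.mem_stdSimplex.2]
  exact Finset.sum_le_sum_of_subset_of_nonneg (Finset.subset_univ _)
    fun w _ _ => hπ.mem_stdSimplex.1 w

theorem mass_nonneg {P : Matrix K K ℝ} {π : K → ℝ} (hπ : IsStationary P π) (A : Finset K) :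
    0 ≤ mass π A := Finset.sum_nonneg fun w _ => hπ.mem_stdSimplex.1 w

theorem mass_mono {P : Matrix K K ℝ} {π : K → ℝ} (hπ : IsStationary P π) {A B : Finset K}
    (h : A ⊆ B) : mass π A ≤ mass π B :=
  Finset.sum_le_sum_of_subset_of_nonneg h fun w _ _ => hπ.mem_stdSimplex.1 w

theorem mass_univ {P : Matrix K K ℝ} {π : K → ℝ} (hπ : IsStationary P π) :
    mass π Finset.univ = 1 := hπ.mem_stdSimplex.2

variable [DecidableEq K]

theorem mass_compl {P : Matrix K K ℝ} {π : K → ℝ} (hπ : IsStationary P π) (A : Finset K) :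
    mass π Aᶜ = 1 - mass π A := by
  rw [← mass_univ hπ]
  exact eq_sub_of_add_eq (Finset.sum_compl_add_sum A π)

theorem mass_pos {P : Matrix K K ℝ} {π : K → ℝ} (hP : IsMarkovChain P) (hπ : IsStationary P π)
    {A : Finset K} (hA : A.Nonempty) : 0 < mass π A :=
  Finset.sum_pos (fun v _ => hπ.pos hP v) hA

theorem entry_nonneg {P : Matrix K K ℝ} {π : K → ℝ} (hP : IsMarkovChain P)
    (hπ : IsStationary P π) (A : Finset K) (y : K) : 0 ≤ entry P π A y :=
  Finset.sum_nonneg fun x _ => div_nonneg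
    (mul_nonneg (hπ.pos hP x).le (hP.nonneg x y)) (hπ.pos hP y).le

theorem entry_univ {P : Matrix K K ℝ} {π : K → ℝ} (hP : IsMarkovChain P)
    (hπ : IsStationary P π) (y : K) : entry P π Finset.univ y = 1 := by
  simp only [entry, reversal]
  rw [← Finset.sum_div, hπ.sum_eq, div_self (hπ.pos hP y).ne']

theorem entry_compl {P : Matrix K K ℝ} {π : K → ℝ} (hP : IsMarkovChain P)
    (hπ : IsStationary P π) (A : Finset K) (y : K) : entry P π Aᶜ y = 1 - entry P π A y := by
  rw [← entry_univ hP hπ y]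
  exact eq_sub_of_add_eq (Finset.sum_compl_add_sum A _)

theorem entry_le_one {P : Matrix K K ℝ} {π : K → ℝ} (hP : IsMarkovChain P)
    (hπ : IsStationary P π) (A : Finset K) (y : K) : entry P π A y ≤ 1 := by
  linarith [entry_compl hP hπ A y, entry_nonneg hP hπ Aᶜ y]

theorem half_le_entry {P : Matrix K K ℝ} {π : K → ℝ} (hP : IsMarkovChain P) (hlazy : IsLazy P)
    (hπ : IsStationary P π) {A : Finset K} {y : K} (hy : y ∈ A) : 1 / 2 ≤ entry P π A y := by
  have h1 : reversal P π y y = P y y := by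
    rw [reversal, mul_div_assoc, mul_comm, div_mul_cancel₀ _ (hπ.pos hP y).ne']
  refine (hlazy y).trans (h1.symm.le.trans (Finset.single_le_sum
    (f := fun x => reversal P π y x) (fun x _ => ?_) hy))
  exact div_nonneg (mul_nonneg (hπ.pos hP x).le (hP.nonneg x y)) (hπ.pos hP y).le

theorem entry_le_half {P : Matrix K K ℝ} {π : K → ℝ} (hP : IsMarkovChain P) (hlazy : IsLazy P)
    (hπ : IsStationary P π) {A : Finset K} {y : K} (hy : y ∉ A) : entry P π A y ≤ 1 / 2 := by
  have := half_le_entry hP hlazy hπ (Finset.mem_compl.2 hy)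
  linarith [entry_compl hP hπ A y]

/-- Laziness makes one half the threshold: the entry probability is at least `1/2` on `A` and at
most `1/2` off `A`, so low levels enlarge `A` and high levels shrink it. -/
theorem subset_levelSet {P : Matrix K K ℝ} {π : K → ℝ} (hP : IsMarkovChain P) (hlazy : IsLazy P)
    (hπ : IsStationary P π) (A : Finset K) {u : ℝ} (hu : u < 1 / 2) :
    A ⊆ levelSet P π A u := fun _ hy =>
  mem_levelSet.2 (hu.trans_le (half_le_entry hP hlazy hπ hy))

theorem levelSet_subset {P : Matrix K K ℝ} {π : K → ℝ} (hP : IsMarkovChain P) (hlazy : IsLazy P)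
    (hπ : IsStationary P π) (A : Finset K) {u : ℝ} (hu : 1 / 2 ≤ u) :
    levelSet P π A u ⊆ A := fun y hy => by
  by_contra hyA
  linarith [mem_levelSet.1 hy, entry_le_half hP hlazy hπ hyA]

theorem integral_indicator_lt {a b c : ℝ} (hac : a ≤ c) (hcb : c ≤ b) :
    ∫ u in a..b, (if u < c then (1 : ℝ) else 0) = c - a := by
  have hi : ∀ x y, IntervalIntegrable (fun u => if u < c then (1 : ℝ) else 0) volume x y :=
    fun x y => Antitone.intervalIntegrable fun u v huv => by

      split_ifs <;> linarith
  rw [← intervalIntegral.integral_add_adjacent_intervals (hi a c) (hi c b)]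
  have h1 : ∫ u in a..c, (if u < c then (1 : ℝ) else 0) = ∫ u in a..c, (1 : ℝ) := by
    rw [intervalIntegral.integral_of_le hac, intervalIntegral.integral_of_le hac,
      integral_Ioc_eq_integral_Ioo, integral_Ioc_eq_integral_Ioo]
    exact setIntegral_congr_fun measurableSet_Ioo fun u hu => by simp [hu.2]
  have h2 : ∫ u in c..b, (if u < c then (1 : ℝ) else 0) = 0 := by
    rw [intervalIntegral.integral_congr (g := fun _ => (0 : ℝ))]
    · simp
    · intro u hu
      rw [Set.uIcc_of_le hcb] at hu
      simp [not_lt.2 hu.1]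
  rw [h1, h2]
  simp

theorem integral_levelSet_indicator {P : Matrix K K ℝ} {π : K → ℝ} (hP : IsMarkovChain P)
    (hπ : IsStationary P π) (A : Finset K) (y : K) :
    ∫ u in (0 : ℝ)..1, (if y ∈ levelSet P π A u then (1 : ℝ) else 0) = entry P π A y := by
  simp only [mem_levelSet]
  rw [integral_indicator_lt (entry_nonneg hP hπ A y) (entry_le_one hP hπ A y), sub_zero]

theorem sum_mul_entry {P : Matrix K K ℝ} {π : K → ℝ} (hP : IsMarkovChain P)
    (hπ : IsStationary P π) (A : Finset K) : ∑ y, π y * entry P π A y = mass π A := by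
  simp only [entry, Finset.mul_sum, reversal]
  rw [Finset.sum_comm]
  refine Finset.sum_congr rfl fun x _ => ?_
  have h : ∀ y, π y * (π x * P x y / π y) = π x * P x y := fun y =>
    mul_div_cancel₀ _ (hπ.pos hP y).ne'
  simp_rw [h, ← Finset.mul_sum, hP.row_sum, mul_one]

theorem mass_eq_sum_ite (π : K → ℝ) (S : Finset K) :
    mass π S = ∑ y, π y * (if y ∈ S then 1 else 0) := by
  simp [mass]

/-- The martingale property of evolving sets: state by state the level integral is the entry
probability, and the rows of `P` sum to one. -/
theorem integral_mass_levelSet {P : Matrix K K ℝ} {π : K → ℝ} (hP : IsMarkovChain P)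
    (hπ : IsStationary P π) (A : Finset K) :
    ∫ u in (0 : ℝ)..1, mass π (levelSet P π A u) = mass π A := by
  simp_rw [mass_eq_sum_ite π (levelSet _ _ _ _)]
  rw [intervalIntegral.integral_finsetSum fun y _ =>
    (intervalIntegrable_comp_levelSet P π A
      (fun S => if y ∈ S then (1 : ℝ) else 0) 0 1).const_mul _]
  simp_rw [intervalIntegral.integral_const_mul, integral_levelSet_indicator hP hπ]
  exact sum_mul_entry hP hπ A

/-- The level sets of the complement are, up to finitely many levels, complements of level sets. -/
theorem integral_comp_levelSet_compl {P : Matrix K K ℝ} {π : K → ℝ} (hP : IsMarkovChain P)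
    (hπ : IsStationary P π) (A : Finset K) (φ : Finset K → ℝ) (a b : ℝ) :
    ∫ u in a..b, φ (levelSet P π Aᶜ u) =
      ∫ u in (1 - b)..(1 - a), φ (levelSet P π A u)ᶜ := by
  have h := intervalIntegral.integral_comp_sub_left (a := a) (b := b)
    (fun u => φ (levelSet P π A u)ᶜ) 1
  rw [← h]
  refine intervalIntegral.integral_congr_ae ?_
  -- Complementation exchanges strict and weak inequality, which matters only at these finitely many
  -- levels.
  have hfin : (Set.range fun y => 1 - entry P π A y).Finite := Set.finite_range _
  filter_upwards [compl_mem_ae_iff.2 (hfin.measure_zero volume)] with u hu _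
  congr 1
  ext y
  rw [Finset.mem_compl, mem_levelSet, mem_levelSet, entry_compl hP hπ, not_lt]
  have : 1 - entry P π A y ≠ u := fun h => hu ⟨y, h⟩
  constructor
  · exact fun h => by linarith
  · exact fun h => lt_of_le_of_ne (by linarith) this.symm

end Basic

/-! ### The flow profile of a set -/

/-- Fractional weights on the states of `A` that fill the level sets greedily. -/
theorem exists_greedy_weights {K : Type*} (w : K → ℝ) (hw : ∀ v, 0 < w v) (k : K → ℝ)
    (A : Finset K) {t : ℝ} (ht0 : 0 ≤ t) (ht : t ≤ ∑ v ∈ A, w v) :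
    ∃ β : K → ℝ, (∀ v, 0 ≤ β v ∧ β v ≤ w v) ∧ ∑ v ∈ A, β v = t ∧
      ∀ u, ∑ v ∈ A, (if u < k v then 0 else β v) =
        max (t - ∑ v ∈ A.filter (fun v => u < k v), w v) 0 := by
  classical
  rcases A.eq_empty_or_nonempty with rfl | hA
  · refine ⟨0, fun v => ⟨le_rfl, (hw v).le⟩, ?_, fun u => ?_⟩
    · simp at ht ⊢; linarith
    · simp at ht ⊢; exact ht
  obtain ⟨v₀, hv₀, hmin⟩ := A.exists_min_image k hA
  -- States are filled in decreasing order of `k`. The value `k c` is where the filling stops: the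
  -- largest one whose weak superlevel set has weight at least `t`.
  obtain ⟨c, hcm, hmax⟩ := (A.filter fun v => t ≤ ∑ z ∈ A.filter (fun z => k v ≤ k z), w z)
    |>.exists_max_image k ⟨v₀, by
      simp only [Finset.mem_filter, hv₀, true_and]
      rwa [Finset.filter_true_of_mem hmin]⟩
  rw [Finset.mem_filter] at hcm
  obtain ⟨hcA, hct⟩ := hcm
  have hsplit : ∑ z ∈ A.filter (fun z => k c ≤ k z), w z =
      ∑ z ∈ A.filter (fun z => k c < k z), w z + ∑ z ∈ A.filter (fun z => k z = k c), w z := by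
    rw [← Finset.sum_union]
    · congr 1
      ext z
      simp only [Finset.mem_filter, Finset.mem_union, ← and_or_left, le_iff_lt_or_eq,
        eq_comm (a := k c)]
    · rw [Finset.disjoint_filter]
      intro z _ h1 h2
      exact h1.ne' h2
  set top := ∑ z ∈ A.filter (fun z => k c < k z), w z with htop
  set mid := ∑ z ∈ A.filter (fun z => k z = k c), w z with hmid
  have hmidpos : 0 < mid := Finset.sum_pos (fun z _ => hw z) ⟨c, by simp [hcA]⟩
  -- Otherwise the lowest state strictly above `c` would still qualify, against maximality.
  have htopt : top ≤ t := by
    rcases (A.filter (fun z => k c < k z)).eq_empty_or_nonempty with he | hne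
    · rw [htop, he]; simpa using ht0
    · obtain ⟨d, hd, hdmin⟩ := Finset.exists_min_image _ k hne
      rw [Finset.mem_filter] at hd
      by_contra! hlt
      have h1 : A.filter (fun z => k d ≤ k z) = A.filter (fun z => k c < k z) := by
        ext z
        simp only [Finset.mem_filter, and_congr_right_iff]
        intro hz
        exact ⟨fun h => hd.2.trans_le h, fun h => hdmin z (by simp [hz, h])⟩
      have := hmax d (by
        rw [Finset.mem_filter, h1]
        exact ⟨hd.1, hlt.le⟩)
      linarith [hd.2]
  set θ := (t - top) / mid with hθ
  have hθ0 : 0 ≤ θ := div_nonneg (by linarith) hmidpos.le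
  have hθ1 : θ ≤ 1 := (div_le_one hmidpos).2 (by linarith)
  have hθm : θ * mid = t - top := div_mul_cancel₀ _ hmidpos.ne'
  -- Full weight above the critical value, a common fraction at ties, nothing below; `θ` makes the
  -- total equal to `t`.
  let β : K → ℝ := fun z => if k c < k z then w z else if k z = k c then θ * w z else 0
  have hβs : ∀ z, β z = (if k c < k z then w z else 0) + θ * (if k z = k c then w z else 0) := by
    intro z
    simp only [β]
    split_ifs with h1 h2
    · exact absurd h2 h1.ne'
    all_goals simp
  have hsum : ∑ v ∈ A, β v = t := by
    simp_rw [hβs]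
    rw [Finset.sum_add_distrib, ← Finset.mul_sum, ← Finset.sum_filter, ← Finset.sum_filter,
      ← htop, ← hmid, hθm]
    ring
  refine ⟨β, fun z => ?_, hsum, fun u => ?_⟩
  · simp only [β]
    have := hw z
    split_ifs
    · exact ⟨this.le, le_rfl⟩
    · exact ⟨by positivity, mul_le_of_le_one_left this.le hθ1⟩
    · exact ⟨le_rfl, this.le⟩
  · rcases lt_or_ge u (k c) with hu | hu
    · rw [Finset.sum_eq_zero, max_eq_right]
      · have : ∑ z ∈ A.filter (fun z => k c ≤ k z), w z ≤
            ∑ v ∈ A.filter (fun v => u < k v), w v :=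
          Finset.sum_le_sum_of_subset_of_nonneg
            (Finset.monotone_filter_right _ fun z _ h => hu.trans_le h) fun z _ _ => (hw z).le
        linarith
      · intro v _
        simp only [β]
        split_ifs <;> first | rfl | (exfalso; linarith)
    · have h1 : ∑ v ∈ A.filter (fun v => u < k v), w v =
          ∑ v ∈ A, if u < k v then β v else 0 := by
        rw [Finset.sum_filter]
        refine Finset.sum_congr rfl fun v _ => ?_
        split_ifs with h
        · simp [β, hu.trans_lt h]
        · rfl
      have h2 : ∑ v ∈ A, (if u < k v then 0 else β v) =
          t - ∑ v ∈ A.filter (fun v => u < k v), w v := by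
        rw [h1, ← hsum, ← Finset.sum_sub_distrib]
        refine Finset.sum_congr rfl fun v _ => ?_
        split_ifs <;> simp
      have h3 : ∑ v ∈ A.filter (fun v => u < k v), w v ≤ top :=
        Finset.sum_le_sum_of_subset_of_nonneg
          (Finset.monotone_filter_right _ fun z _ h => hu.trans_lt h) fun z _ _ => (hw z).le
      rw [h2, max_eq_left (by linarith)]

namespace Continuization

variable {K : Type*} {π : K → ℝ} (C : Continuization π)

theorem measurableSet_block (v : K) : MeasurableSet (C.block v) := measurableSet_Icc

theorem volume_inter_block_ne_top (S : Set ℝ) (v : K) : volume (S ∩ C.block v) ≠ ⊤ :=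
  ((measure_mono Set.inter_subset_right).trans_lt measure_Icc_lt_top).ne

theorem volume_block (v : K) (hπ : 0 ≤ π v) : volume.real (C.block v) = π v := by
  simp [block, measureReal_def, hπ]

theorem aedisjoint_inter_block (S : Set ℝ) (A : Finset K) :
    (A : Set K).Pairwise (Function.onFun (AEDisjoint volume) fun v => S ∩ C.block v) :=
  fun x _ y _ hxy => measure_mono_null
    (Set.inter_subset_inter Set.inter_subset_right Set.inter_subset_right) (C.overlap x y hxy)

theorem volume_eq_sum {A : Finset K} {B : Set ℝ} (hB : MeasurableSet B) (hBA : B ⊆ C.lift A) :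
    volume.real B = ∑ v ∈ A, volume.real (B ∩ C.block v) := by
  have h : B = ⋃ v ∈ A, B ∩ C.block v := by
    rw [← Set.inter_iUnion₂]
    exact (Set.inter_eq_left.2 hBA).symm
  conv_lhs => rw [h]
  exact measureReal_biUnion_finset₀ (C.aedisjoint_inter_block B A)
    (fun v _ => (hB.inter (C.measurableSet_block v)).nullMeasurableSet)
    (fun v _ => C.volume_inter_block_ne_top B v)

theorem volume_lift_inter_block_of_notMem {A : Finset K} {v : K} (hv : v ∉ A) :
    volume (C.lift A ∩ C.block v) = 0 := by
  rw [lift, Set.iUnion₂_inter]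
  exact (measure_biUnion_null_iff A.countable_toSet).2 fun w hw =>
    C.overlap w v fun h => hv (h ▸ hw)

theorem volume_lift_inter_block_of_mem {A : Finset K} {v : K} (hv : v ∈ A) (hπ : 0 ≤ π v) :
    volume.real (C.lift A ∩ C.block v) = π v := by
  have h : C.block v ⊆ C.lift A := Set.subset_biUnion_of_mem (u := C.block) hv
  rw [Set.inter_eq_right.2 h, C.volume_block v hπ]

variable [DecidableEq K] in
/-- Every family of fractional weights is the family of block measures of a measurable set. -/
theorem exists_set_of_weights (A : Finset K) (β : K → ℝ) (hβ : ∀ v, 0 ≤ β v ∧ β v ≤ π v) :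
    ∃ B : Set ℝ, MeasurableSet B ∧ B ⊆ C.lift A ∧
      ∀ v ∈ A, volume.real (B ∩ C.block v) = β v := by
  have hsub : ∀ v, Set.Icc (C.left v) (C.left v + β v) ⊆ C.block v := fun v =>
    Set.Icc_subset_Icc_right (by linarith [(hβ v).2])
  -- Take initial segments of the blocks. Distinct blocks meet in null sets, so segments of other
  -- blocks add no measure.
  refine ⟨⋃ v ∈ A, Set.Icc (C.left v) (C.left v + β v),
    Finset.measurableSet_biUnion _ fun v _ => measurableSet_Icc,
    Set.iUnion₂_mono fun v _ => hsub v, fun v hv => ?_⟩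
  have h1 : volume.real (Set.Icc (C.left v) (C.left v + β v)) = β v := by
    simp [measureReal_def, (hβ v).1]
  rw [← h1]
  refine measureReal_congr (Filter.EventuallyEq.symm ?_)
  refine ae_eq_of_subset_of_measure_ge (Set.subset_inter
    (Set.subset_biUnion_of_mem (u := fun v => Set.Icc (C.left v) (C.left v + β v))
      (s := (A : Set K)) hv) (hsub v)) ?_ measurableSet_Icc.nullMeasurableSet ?_
  · have h2 : (⋃ w ∈ A, Set.Icc (C.left w) (C.left w + β w)) ∩ C.block v ⊆
        Set.Icc (C.left v) (C.left v + β v) ∪ (C.lift (A.erase v) ∩ C.block v) := by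
      rintro z ⟨hz, hzv⟩
      obtain ⟨w, hw, hzw⟩ := Set.mem_iUnion₂.1 hz
      by_cases h : w = v
      · exact Or.inl (h ▸ hzw)
      · exact Or.inr ⟨Set.mem_iUnion₂.2 ⟨w, Finset.mem_erase.2 ⟨h, hw⟩, hsub w hzw⟩, hzv⟩
    refine (measure_mono h2).trans ((measure_union_le _ _).trans ?_)
    rw [C.volume_lift_inter_block_of_notMem (Finset.notMem_erase v A), add_zero]
  · exact C.volume_inter_block_ne_top _ _

variable [Fintype K]

theorem Q_lift {P : Matrix K K ℝ} (hπ : ∀ v, 0 < π v) (A : Finset K) (B : Set ℝ) :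
    C.Q P (C.lift A) B = ∑ y, volume.real (B ∩ C.block y) * entry P π A y := by
  classical
  rw [Q, Finset.sum_comm]
  refine Finset.sum_congr rfl fun y _ => ?_
  rw [entry, Finset.mul_sum, ← Finset.sum_subset (Finset.subset_univ A)]
  · refine Finset.sum_congr rfl fun x hx => ?_
    rw [C.volume_lift_inter_block_of_mem hx (hπ x).le, div_self (hπ x).ne', flow, reversal]
    ring
  · intro x _ hx
    rw [measureReal_def, C.volume_lift_inter_block_of_notMem hx]
    simp

variable [DecidableEq K]

/-- Layer-cake formula: for `y ∈ A` the entry probability is at least `1/2`, so the probability of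
entering `Aᶜ` is the length of the levels in `[1/2,1]` whose level set misses `y`. -/
theorem Q_lift_compl {P : Matrix K K ℝ} (hP : IsMarkovChain P) (hlazy : IsLazy P)
    (hπ : IsStationary P π) (A : Finset K) {B : Set ℝ} (hB : B ⊆ C.lift A) :
    C.Q P (C.lift Aᶜ) B = ∫ u in (1 / 2 : ℝ)..1,
      ∑ y ∈ A, if y ∈ levelSet P π A u then 0 else volume.real (B ∩ C.block y) := by
  rw [C.Q_lift (hπ.pos hP), intervalIntegral.integral_finsetSum fun y _ =>
    intervalIntegrable_comp_levelSet P π A (fun S => if y ∈ S then 0 else _) _ _,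
    ← Finset.sum_subset (Finset.subset_univ A)]
  · refine Finset.sum_congr rfl fun y hy => ?_
    have h : ∀ u, (if y ∈ levelSet P π A u then 0 else volume.real (B ∩ C.block y)) =
        volume.real (B ∩ C.block y) * (1 - if u < entry P π A y then 1 else 0) := by
      intro u
      simp only [mem_levelSet]
      split_ifs <;> simp
    have hi : IntervalIntegrable (fun u => if u < entry P π A y then (1 : ℝ) else 0)
        volume (1 / 2) 1 := by
      simpa only [mem_levelSet] using
        intervalIntegrable_comp_levelSet P π A (fun S => if y ∈ S then (1 : ℝ) else 0) (1 / 2) 1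
    simp_rw [h]
    rw [intervalIntegral.integral_const_mul, intervalIntegral.integral_sub
      intervalIntegrable_const hi, integral_indicator_lt (half_le_entry hP hlazy hπ hy)
      (entry_le_one hP hπ A y), entry_compl hP hπ, intervalIntegral.integral_const, smul_eq_mul]
    ring
  · intro y _ hy
    have : volume (B ∩ C.block y) = 0 := measure_mono_null (Set.inter_subset_inter_left _ hB)
      (C.volume_lift_inter_block_of_notMem hy)
    simp [measureReal_def, this]

theorem sum_filter_eq_mass_levelSet {P : Matrix K K ℝ} (hP : IsMarkovChain P) (hlazy : IsLazy P)
    (hπ : IsStationary P π) (A : Finset K) {u : ℝ} (hu : 1 / 2 ≤ u) :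
    ∑ v ∈ A.filter (fun v => u < entry P π A v), π v = mass π (levelSet P π A u) := by
  refine Finset.sum_congr ?_ fun _ _ => rfl
  ext v
  simp only [Finset.mem_filter, ← mem_levelSet]
  exact ⟨fun h => h.2, fun h => ⟨levelSet_subset hP hlazy hπ A hu h, h⟩⟩

/-- At each level the part of `B` outside `A_u` has measure at least `(t - π(A_u))⁺`. The level sets
are nested, so the greedy set attains this bound at all levels simultaneously. -/
theorem minFlow_eq {P : Matrix K K ℝ} (hP : IsMarkovChain P) (hlazy : IsLazy P)
    (hπ : IsStationary P π) (A : Finset K) {t : ℝ} (ht0 : 0 ≤ t) (ht : t ≤ mass π A) :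
    C.minFlow P t A = ∫ u in (1 / 2 : ℝ)..1, max (t - mass π (levelSet P π A u)) 0 := by
  have hle : ∀ u ∈ Set.uIcc (1 / 2 : ℝ) 1, 1 / 2 ≤ u := fun u hu => by
    rw [Set.uIcc_of_le (by norm_num)] at hu
    exact hu.1
  refine IsLeast.csInf_eq ⟨?_, ?_⟩
  · obtain ⟨β, hβ, hsum, hlev⟩ :=
      exists_greedy_weights π (hπ.pos hP) (entry P π A) A ht0 ht
    obtain ⟨B, hB, hBA, hvol⟩ := C.exists_set_of_weights A β hβ
    refine ⟨B, hB, hBA, ?_, ?_⟩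
    · rw [C.volume_eq_sum hB hBA, ← hsum]
      exact Finset.sum_congr rfl hvol
    · rw [C.Q_lift_compl hP hlazy hπ A hBA]
      refine intervalIntegral.integral_congr fun u hu => ?_
      rw [← sum_filter_eq_mass_levelSet hP hlazy hπ A (hle u hu), ← hlev u]
      refine Finset.sum_congr rfl fun v hv => ?_
      simp only [mem_levelSet, hvol v hv]
  · rintro r ⟨B, hB, hBA, rfl, rfl⟩
    rw [C.Q_lift_compl hP hlazy hπ A hBA]
    refine intervalIntegral.integral_mono_on (by norm_num)
      (intervalIntegrable_comp_levelSet P π A (fun S => max (_ - mass π S) 0) _ _)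
      (intervalIntegrable_comp_levelSet P π A
        (fun S => ∑ y ∈ A, if y ∈ S then 0 else volume.real (B ∩ C.block y)) _ _) fun u hu => ?_
    refine max_le ?_ (Finset.sum_nonneg fun y _ => by split_ifs <;> positivity)
    rw [C.volume_eq_sum hB hBA, ← sum_filter_eq_mass_levelSet hP hlazy hπ A hu.1,
      Finset.sum_filter, ← Finset.sum_sub_distrib]
    refine Finset.sum_le_sum fun y _ => ?_
    simp only [mem_levelSet]
    split_ifs
    · rw [sub_nonpos, ← C.volume_block y (hπ.pos hP y).le]
      exact measureReal_mono Set.inter_subset_right measure_Icc_lt_top.ne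
    · simp

theorem revPsi_of_le {P : Matrix K K ℝ} (hP : IsMarkovChain P) (hlazy : IsLazy P)
    (hπ : IsStationary P π) (A : Finset K) {t : ℝ} (ht0 : 0 ≤ t) (ht : t ≤ mass π A) :
    C.revPsi P t A = ∫ u in (1 / 2 : ℝ)..1, max (t - mass π (levelSet P π A u)) 0 := by
  rw [revPsi, if_pos ht, C.minFlow_eq hP hlazy hπ A ht0 ht]

/-- This is the formula for `Aᶜ`, transported by the reflection `u ↦ 1 - u` of the levels. -/
theorem revPsi_of_lt {P : Matrix K K ℝ} (hP : IsMarkovChain P) (hlazy : IsLazy P)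
    (hπ : IsStationary P π) (A : Finset K) {t : ℝ} (ht : mass π A < t) (ht1 : t ≤ 1) :
    C.revPsi P t A = ∫ u in (0 : ℝ)..(1 / 2), max (mass π (levelSet P π A u) - t) 0 := by
  rw [revPsi, if_neg (not_le.2 ht), C.minFlow_eq hP hlazy hπ Aᶜ (by linarith)
    (by rw [mass_compl hπ]; linarith),
    integral_comp_levelSet_compl hP hπ A (fun S => max (1 - t - mass π S) 0)]
  simp_rw [mass_compl hπ]
  norm_num

end Continuization

/-! ### Comparison of the set quantities -/

/-! ### One-variable integrals and inequalities. -/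

theorem intervalIntegrable_of_abs_le {f : ℝ → ℝ} {a b M : ℝ} (hf : Measurable f)
    (h : ∀ t ∈ Set.uIoc a b, |f t| ≤ M) : IntervalIntegrable f volume a b := by
  rw [intervalIntegrable_iff]
  exact Measure.integrableOn_of_bounded (M := M) measure_Ioc_lt_top.ne
    hf.aestronglyMeasurable ((ae_restrict_iff' measurableSet_uIoc).2 (.of_forall h))

theorem integral_max_sub {a b : ℝ} (hb : 0 ≤ b) (hba : b ≤ a) :
    ∫ t in (0 : ℝ)..a, max (t - b) 0 = (a - b) ^ 2 / 2 := by
  have hi : ∀ x y, IntervalIntegrable (fun t : ℝ => max (t - b) 0) volume x y := fun x y =>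
    Continuous.intervalIntegrable (by fun_prop) _ _
  rw [← intervalIntegral.integral_add_adjacent_intervals (hi 0 b) (hi b a)]
  have h1 : ∫ t in (0 : ℝ)..b, max (t - b) 0 = 0 := by
    rw [intervalIntegral.integral_congr (g := fun _ => (0 : ℝ))]
    · simp
    · intro t ht
      rw [Set.uIcc_of_le hb] at ht
      exact max_eq_right (by linarith [ht.2])
  have h2 : ∫ t in b..a, max (t - b) 0 = ∫ t in b..a, (t - b) := by
    refine intervalIntegral.integral_congr fun t ht => ?_
    rw [Set.uIcc_of_le hba] at ht
    exact max_eq_left (by linarith [ht.1])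
  rw [h1, h2, intervalIntegral.integral_sub (by simp) (by simp), integral_id,
    intervalIntegral.integral_const, smul_eq_mul]
  ring

/-- On `[b,a]` the integrand is `1 - b/t`, whose integral is exactly the left-hand side; the rest is
nonnegative. At `b = 0` the logarithmic term vanishes. -/
theorem mul_log_sub_le_integral_left {a b : ℝ} (ha : 0 < a) (hb : 0 ≤ b) (hba : b ≤ a) :
    b * Real.log (b / a) - (b - a) ≤ ∫ t in (0 : ℝ)..a, max (t - b) 0 / t := by
  have hi : ∀ x y, 0 ≤ x → x ≤ y →
      IntervalIntegrable (fun t : ℝ => max (t - b) 0 / t) volume x y := fun x y hx hxy =>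
    intervalIntegrable_of_abs_le (M := 1) (by fun_prop) fun t ht => by
      rw [Set.uIoc_of_le hxy] at ht
      have ht0 : 0 < t := hx.trans_lt ht.1
      rw [abs_of_nonneg (by positivity), div_le_one ht0]
      exact max_le (by linarith) ht0.le
  rw [← intervalIntegral.integral_add_adjacent_intervals (hi 0 b le_rfl hb) (hi b a hb hba)]
  have h1 : 0 ≤ ∫ t in (0 : ℝ)..b, max (t - b) 0 / t :=
    intervalIntegral.integral_nonneg hb fun t ht => div_nonneg (le_max_right _ _) ht.1
  have h2 : ∫ t in b..a, max (t - b) 0 / t = ∫ t in b..a, (1 - b * t⁻¹) := by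
    refine intervalIntegral.integral_congr_ae (.of_forall fun t ht => ?_)
    rw [Set.uIoc_of_le hba] at ht
    have ht0 : 0 < t := hb.trans_lt ht.1
    rw [max_eq_left (by linarith [ht.1])]
    field_simp
  have h3 : ∫ t in b..a, (1 - b * t⁻¹) = (a - b) + b * Real.log (b / a) := by
    rcases hb.eq_or_lt with rfl | hb
    · simp
    · rw [intervalIntegral.integral_sub (by simp), intervalIntegral.integral_const_mul,
        integral_inv_of_pos hb ha, intervalIntegral.integral_const, smul_eq_mul,
        Real.log_div ha.ne' hb.ne', Real.log_div hb.ne' ha.ne']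
      · ring
      · refine (intervalIntegral.intervalIntegrable_inv (fun t ht => ?_)
          continuousOn_id).const_mul b
        rw [Set.uIcc_of_le hba] at ht
        exact (hb.trans_le ht.1).ne'
  rw [h2, h3]
  linarith

theorem mul_log_sub_le_integral_right {a b : ℝ} (ha : 0 < a) (hab : a ≤ b) (hb1 : b ≤ 1) :
    b * Real.log (b / a) - (b - a) ≤ ∫ t in a..1, max (b - t) 0 / t := by
  have hb : 0 < b := ha.trans_le hab
  have hi : ∀ x y, 0 < x → x ≤ y →
      IntervalIntegrable (fun t : ℝ => max (b - t) 0 / t) volume x y := fun x y hx hxy =>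
    ContinuousOn.intervalIntegrable (ContinuousOn.div (by fun_prop) (by fun_prop)
      fun t ht => by
        rw [Set.uIcc_of_le hxy] at ht
        exact (hx.trans_le ht.1).ne')
  rw [← intervalIntegral.integral_add_adjacent_intervals (hi a b ha hab) (hi b 1 hb hb1)]
  have h1 : 0 ≤ ∫ t in b..1, max (b - t) 0 / t :=
    intervalIntegral.integral_nonneg hb1 fun t ht =>
      div_nonneg (le_max_right _ _) (hb.le.trans ht.1)
  have h2 : ∫ t in a..b, max (b - t) 0 / t = ∫ t in a..b, (b * t⁻¹ - 1) := by
    refine intervalIntegral.integral_congr fun t ht => ?_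
    rw [Set.uIcc_of_le hab] at ht
    have ht0 : 0 < t := ha.trans_le ht.1
    rw [max_eq_left (by linarith [ht.2])]
    field_simp
  have h3 : ∫ t in a..b, (b * t⁻¹ - 1) = b * Real.log (b / a) - (b - a) := by
    rw [intervalIntegral.integral_sub _ (by simp), intervalIntegral.integral_const_mul,
      integral_inv_of_pos ha hb, intervalIntegral.integral_const, smul_eq_mul]
    · ring
    · refine (intervalIntegral.intervalIntegrable_inv (fun t ht => ?_)
        continuousOn_id).const_mul b
      rw [Set.uIcc_of_le hab] at ht
      exact (ha.trans_le ht.1).ne'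
  rw [h2, h3]
  linarith

/-- Weighing with `1 / (2 a min(s,1-s))` gives at most as much as weighing with `1 / a²`. -/
theorem half_integral_min_le {a c T : ℝ} (ha : 0 < a) (ha2 : a ≤ 1 / 2) (hc : 0 ≤ c)
    (haT : a ≤ T) (hT : T ≤ 1 - a) :
    1 / 2 * ∫ s in (0 : ℝ)..T, max (s - c) 0 * (1 / (a * min s (1 - s))) ≤
      ∫ s in (0 : ℝ)..T, max (s - c) 0 * (1 / a ^ 2) := by
  have hi1 : ∀ x y, IntervalIntegrable (fun s : ℝ => max (s - c) 0 * (1 / a ^ 2)) volume x y :=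
    fun x y => Continuous.intervalIntegrable (by fun_prop) _ _
  have hi2 : ∀ x y, 0 ≤ x → x ≤ y → y ≤ T →
      IntervalIntegrable (fun s : ℝ => max (s - c) 0 * (1 / (a * min s (1 - s)))) volume x y := by
    intro x y hx hxy hy
    refine intervalIntegrable_of_abs_le (M := 1 / a + 1 / a ^ 2) (by fun_prop) fun s hs => ?_
    rw [Set.uIoc_of_le hxy] at hs
    have hs0 : 0 < s := hx.trans_lt hs.1
    have hs1 : a ≤ 1 - s := by linarith [hs.2]
    have hmin : 0 < min s (1 - s) := lt_min hs0 (by linarith)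
    rw [abs_of_nonneg (by positivity)]
    have hle : max (s - c) 0 ≤ s := max_le (by linarith) hs0.le
    rcases min_cases s (1 - s) with ⟨h, -⟩ | ⟨h, -⟩
    · rw [h]
      have : s * (1 / (a * s)) = 1 / a := by field_simp
      have h2 : max (s - c) 0 * (1 / (a * s)) ≤ s * (1 / (a * s)) :=
        mul_le_mul_of_nonneg_right hle (by positivity)
      have : 0 ≤ 1 / a ^ 2 := by positivity
      linarith
    · rw [h]
      have h2 : 1 / (a * (1 - s)) ≤ 1 / a ^ 2 := by
        rw [pow_two]
        exact one_div_le_one_div_of_le (by positivity) (by gcongr)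
      have h3 : max (s - c) 0 * (1 / (a * (1 - s))) ≤ 1 * (1 / a ^ 2) := by
        refine mul_le_mul (hle.trans (by linarith)) h2 ?_ zero_le_one
        exact one_div_nonneg.2 (mul_nonneg ha.le (by linarith))
      have : 0 ≤ 1 / a := by positivity
      linarith
  rw [← intervalIntegral.integral_const_mul, ← sub_nonneg,
    ← intervalIntegral.integral_sub (hi1 0 T) ((hi2 0 T le_rfl (ha.le.trans haT) le_rfl).const_mul _)]
  have hi : ∀ x y, 0 ≤ x → x ≤ y → y ≤ T → IntervalIntegrable (fun s : ℝ =>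
      max (s - c) 0 * (1 / a ^ 2) - 1 / 2 * (max (s - c) 0 * (1 / (a * min s (1 - s)))))
      volume x y := fun x y hx hxy hy => (hi1 x y).sub ((hi2 x y hx hxy hy).const_mul _)
  rw [← intervalIntegral.integral_add_adjacent_intervals (hi 0 a le_rfl ha.le haT)
    (hi a T ha.le haT le_rfl)]
  refine add_nonneg ?_ (intervalIntegral.integral_nonneg haT fun s hs => ?_)
  -- On `[0,a]` the difference is a multiple of `((s - c)⁺/s)(2s - a)`. The first factor is
  -- increasing and `2s - a` has mean zero, so freezing the first factor at the sign change `s =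
  -- a/2` gives a lower bound with integral zero.
  · set k := max (a / 2 - c) 0 / (a / 2) with hk
    have h0 : ∫ s in (0 : ℝ)..a, k / (2 * a ^ 2) * (2 * s - a) = 0 := by
      rw [intervalIntegral.integral_const_mul, intervalIntegral.integral_sub
        (intervalIntegral.intervalIntegrable_id.const_mul 2) (by simp),
        intervalIntegral.integral_const_mul, integral_id, intervalIntegral.integral_const,
        smul_eq_mul]
      ring
    refine h0.symm.le.trans ?_
    refine intervalIntegral.integral_mono_on_of_le_Ioo ha.le
      (f := fun s => k / (2 * a ^ 2) * (2 * s - a))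
      (Continuous.intervalIntegrable (by fun_prop) _ _) (hi 0 a le_rfl ha.le haT) fun s hs => ?_
    have hs0 : 0 < s := hs.1
    rw [min_eq_left (by linarith [hs.2])]
    have e1 : max (s - c) 0 * (1 / a ^ 2) - 1 / 2 * (max (s - c) 0 * (1 / (a * s))) =
        1 / (2 * a ^ 2) * (max (s - c) 0 / s * (2 * s - a)) := by
      field_simp
    have e2 : k / (2 * a ^ 2) * (2 * s - a) = 1 / (2 * a ^ 2) * (k * (2 * s - a)) := by ring
    rw [e1, e2]
    refine mul_le_mul_of_nonneg_left ?_ (by positivity)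
    have hmono : ∀ x y : ℝ, 0 < x → x ≤ y → max (x - c) 0 / x ≤ max (y - c) 0 / y := by
      intro x y hx hxy
      have hy : 0 < y := hx.trans_le hxy
      rw [div_le_div_iff₀ hx hy]
      rcases le_total x c with h | h
      · rw [max_eq_right (by linarith)]
        have := le_max_right (y - c) 0
        nlinarith
      · rw [max_eq_left (by linarith), max_eq_left (by linarith)]
        nlinarith
    rcases le_total s (a / 2) with h | h
    · have := hmono s (a / 2) hs0 h
      rw [← hk] at this
      nlinarith
    · have := hmono (a / 2) s (by positivity) h
      rw [← hk] at this
      nlinarith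
  -- Beyond `a` the two weights compare pointwise.
  · have hmin : a / 2 ≤ min s (1 - s) := le_min (by linarith [hs.1]) (by linarith [hs.2])
    have h1 : 1 / 2 * (1 / (a * min s (1 - s))) ≤ 1 / a ^ 2 := by
      have : 1 / (a * min s (1 - s)) ≤ 1 / (a * (a / 2)) :=
        one_div_le_one_div_of_le (by positivity) (by gcongr)
      refine (mul_le_mul_of_nonneg_left this (by norm_num)).trans (le_of_eq ?_)
      field_simp
    have := mul_le_mul_of_nonneg_left h1 (le_max_right (s - c) 0)
    linarith

/-- The evolving-set integrand in terms of the normalised mass. -/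
theorem one_sub_sqrt_le_mul_log {x : ℝ} (hx : 0 ≤ x) :
    (x - 1) / 2 + (1 - √x) ≤ 1 / 2 * (x * Real.log x - (x - 1)) := by
  rcases hx.eq_or_lt with rfl | hx
  · norm_num
  have hy : 0 < √x := Real.sqrt_pos.2 hx
  have hsq : √x ^ 2 = x := Real.sq_sqrt hx.le
  have hlog : Real.log x = 2 * Real.log √x := by
    conv_lhs => rw [← hsq]
    rw [Real.log_pow]
    norm_num
  -- With `y = √x` the claim reduces to `y - 1 ≤ y log y`.
  have h := Real.one_sub_inv_le_log_of_pos hy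
  have h2 : √x - 1 ≤ √x * Real.log √x := by
    have := mul_le_mul_of_nonneg_left h hy.le
    rwa [mul_sub, mul_one, mul_inv_cancel₀ hy.ne'] at this
  have h3 : √x * (√x - 1) ≤ √x * (√x * Real.log √x) := mul_le_mul_of_nonneg_left h2 hy.le
  rw [hlog]
  nlinarith

theorem one_sub_sqrt_ge {x : ℝ} (hx : 0 ≤ x) : (1 - x) / 2 ≤ 1 - √x := by
  have hsq : √x ^ 2 = x := Real.sq_sqrt hx
  nlinarith [sq_nonneg (1 - √x)]

/-- The excess of `1 - √x` over `(1 - x)/2` is `(1 - √x)²/2 = (1 - x)²/(2(1 + √x)²)`, and `1 + √x ≤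
2`. -/
theorem one_sub_sqrt_ge_quadratic {x : ℝ} (hx : 0 ≤ x) (hx1 : x ≤ 1) :
    (1 - x) / 2 + 1 / 4 * ((1 - x) ^ 2 / 2) ≤ 1 - √x := by
  have hsq : √x ^ 2 = x := Real.sq_sqrt hx
  have h0 : 0 ≤ √x := Real.sqrt_nonneg x
  have h1 : √x ≤ 1 := Real.sqrt_le_one.2 hx1
  have h2 : (1 + √x) ^ 2 ≤ 4 := by nlinarith
  have h3 : (1 - √x) ^ 2 * (1 + √x) ^ 2 ≤ (1 - √x) ^ 2 * 4 :=
    mul_le_mul_of_nonneg_left h2 (sq_nonneg _)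
  have h4 : (1 - √x) ^ 2 * (1 + √x) ^ 2 = (1 - x) ^ 2 := by
    rw [← mul_pow, ← hsq, Real.sqrt_sq h0]
    ring
  nlinarith

/-! ### The set quantities as integrals over levels. -/

section

variable {K : Type*} [Fintype K] {P : Matrix K K ℝ} {π : K → ℝ}

theorem levelSet_mass_div_nonneg (hπ : IsStationary P π) (A : Finset K) (u : ℝ) :
    0 ≤ mass π (levelSet P π A u) / mass π A :=
  div_nonneg (mass_nonneg hπ _) (mass_nonneg hπ _)

theorem evoSpread_eq_integral (A : Finset K) :
    evoSpread P π A = ∫ u in (0 : ℝ)..1, (1 - √(mass π (levelSet P π A u) / mass π A)) := by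
  rw [intervalIntegral.integral_sub intervalIntegrable_const
    (intervalIntegrable_comp_levelSet P π A (fun S => √(mass π S / mass π A)) 0 1)]
  simp [evoSpread]

variable [DecidableEq K] (C : Continuization π)

theorem levelSet_mass_div_le_one (hP : IsMarkovChain P) (hlazy : IsLazy P)
    (hπ : IsStationary P π) (A : Finset K) {u : ℝ} (hu : 1 / 2 ≤ u) :
    mass π (levelSet P π A u) / mass π A ≤ 1 :=
  div_le_one_of_le₀ (mass_mono hπ (levelSet_subset hP hlazy hπ A hu)) (mass_nonneg hπ _)

theorem integral_one_sub_levelSet_mass (hP : IsMarkovChain P) (hπ : IsStationary P π)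
    {A : Finset K} (hA : A.Nonempty) :
    ∫ u in (0 : ℝ)..1, (1 - mass π (levelSet P π A u) / mass π A) = 0 := by
  rw [intervalIntegral.integral_sub intervalIntegrable_const
    (intervalIntegrable_comp_levelSet P π A (fun S => mass π S / mass π A) 0 1),
    intervalIntegral.integral_div, integral_mass_levelSet hP hπ,
    div_self (mass_pos hP hπ hA).ne']
  simp

theorem Continuization.spread_eq (hP : IsMarkovChain P) (hlazy : IsLazy P)
    (hπ : IsStationary P π) {A : Finset K} (hA : A.Nonempty) :
    C.spread P A = ∫ u in (1 / 2 : ℝ)..1, (1 - mass π (levelSet P π A u) / mass π A) ^ 2 / 2 := by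
  have ha := mass_pos hP hπ hA
  rw [spread, intervalIntegral.integral_div]
  have h1 : ∫ t in (0 : ℝ)..mass π A, C.revPsi P t A = ∫ t in (0 : ℝ)..mass π A,
      ∫ u in (1 / 2 : ℝ)..1, max (t - mass π (levelSet P π A u)) 0 :=
    intervalIntegral.integral_congr fun t ht => by
      rw [Set.uIcc_of_le ha.le] at ht
      exact C.revPsi_of_le hP hlazy hπ A ht.1 ht.2
  rw [h1, integral_integral_comp_levelSet P π A (fun t S => max (t - mass π S) 0) _ _ _ _
    fun S => Continuous.intervalIntegrable (by fun_prop) _ _, ← intervalIntegral.integral_div]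
  refine intervalIntegral.integral_congr fun u hu => ?_
  rw [Set.uIcc_of_le (by norm_num)] at hu
  rw [integral_max_sub (mass_nonneg hπ _) (mass_mono hπ (levelSet_subset hP hlazy hπ A hu.1))]
  field_simp

/-- The linear part `(1 - x)/2` integrates to zero over all levels, so the quadratic gain is needed
only on `[1/2,1]`, where the spread lives. -/
theorem Continuization.mul_spread_le_evoSpread (hP : IsMarkovChain P) (hlazy : IsLazy P)
    (hπ : IsStationary P π) {A : Finset K} (hA : A.Nonempty) {c : ℝ}
    (hc : ∀ u, 1 / 2 ≤ u → (1 - mass π (levelSet P π A u) / mass π A) / 2 +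
      c * ((1 - mass π (levelSet P π A u) / mass π A) ^ 2 / 2) ≤
        1 - √(mass π (levelSet P π A u) / mass π A)) :
    c * C.spread P A ≤ evoSpread P π A := by
  have hi := fun (φ : ℝ → ℝ) a b =>
    intervalIntegrable_comp_levelSet P π A (fun S => φ (mass π S / mass π A)) a b
  have h0 := integral_one_sub_levelSet_mass hP hπ hA
  rw [← intervalIntegral.integral_add_adjacent_intervals
    (hi (fun x => 1 - x) 0 (1 / 2)) (hi (fun x => 1 - x) (1 / 2) 1)] at h0
  rw [evoSpread_eq_integral, ← intervalIntegral.integral_add_adjacent_intervals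
    (hi (fun x => 1 - √x) 0 (1 / 2)) (hi (fun x => 1 - √x) (1 / 2) 1),
    C.spread_eq hP hlazy hπ hA, ← intervalIntegral.integral_const_mul]
  have h1 := intervalIntegral.integral_mono_on (by norm_num) (hi (fun x => (1 - x) / 2) 0 (1 / 2))
    (hi (fun x => 1 - √x) 0 (1 / 2)) fun u _ =>
      one_sub_sqrt_ge (levelSet_mass_div_nonneg hπ A u)
  have h2 := intervalIntegral.integral_mono_on (by norm_num)
    (hi (fun x => (1 - x) / 2 + c * ((1 - x) ^ 2 / 2)) (1 / 2) 1)
    (hi (fun x => 1 - √x) (1 / 2) 1) fun u hu => hc u hu.1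
  rw [intervalIntegral.integral_add (hi (fun x => (1 - x) / 2) _ _)
    (hi (fun x => c * ((1 - x) ^ 2 / 2)) _ _)] at h2
  simp only [intervalIntegral.integral_div] at h1 h2 ⊢
  linarith

theorem Continuization.quarter_spread_le_evoSpread (hP : IsMarkovChain P) (hlazy : IsLazy P)
    (hπ : IsStationary P π) {A : Finset K} (hA : A.Nonempty) :
    1 / 4 * C.spread P A ≤ evoSpread P π A :=
  C.mul_spread_le_evoSpread hP hlazy hπ hA fun u hu =>
    one_sub_sqrt_ge_quadratic (levelSet_mass_div_nonneg hπ A u)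
      (levelSet_mass_div_le_one hP hlazy hπ A hu)

/-- For a singleton the upper levels give only `x = 0` or `x = 1`, where the pointwise inequality
holds with constant one in place of `1/4`. The gain pays for rounding in the logarithmic bound. -/
theorem Continuization.spread_singleton_le_evoSpread (hP : IsMarkovChain P) (hlazy : IsLazy P)
    (hπ : IsStationary P π) (x : K) : C.spread P {x} ≤ evoSpread P π {x} := by
  rw [← one_mul (C.spread P {x})]
  refine C.mul_spread_le_evoSpread hP hlazy hπ (Finset.singleton_nonempty x) fun u hu => ?_
  have hx := hπ.pos hP x
  rcases Finset.subset_singleton_iff.1 (levelSet_subset hP hlazy hπ {x} hu) with h | h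
  · rw [h]
    norm_num [mass]
  · rw [h]
    norm_num [mass, div_self hx.ne']

theorem Continuization.spread_le_quarter (hP : IsMarkovChain P) (hlazy : IsLazy P)
    (hπ : IsStationary P π) {A : Finset K} (hA : A.Nonempty) : C.spread P A ≤ 1 / 4 := by
  rw [C.spread_eq hP hlazy hπ hA]
  have h := intervalIntegral.integral_mono_on (a := 1 / 2) (b := 1) (by norm_num)
    (intervalIntegrable_comp_levelSet P π A (fun S => (1 - mass π S / mass π A) ^ 2 / 2) _ _)
    (intervalIntegrable_const (c := (1 / 2 : ℝ))) fun u hu => by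
      have h0 := levelSet_mass_div_nonneg hπ A u
      have h1 := levelSet_mass_div_le_one hP hlazy hπ A hu.1
      nlinarith
  refine h.trans (le_of_eq ?_)
  norm_num

theorem Continuization.integral_revPsi_mul (hP : IsMarkovChain P) (hlazy : IsLazy P)
    (hπ : IsStationary P π) (A : Finset K) (w : ℝ → ℝ)
    (h1 : ∀ S, IntervalIntegrable (fun t => max (t - mass π S) 0 * w t) volume 0 (mass π A))
    (h2 : ∀ S, IntervalIntegrable (fun t => max (mass π S - t) 0 * w t) volume (mass π A) 1) :
    ∫ t in (0 : ℝ)..1, C.revPsi P t A * w t =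
      (∫ u in (1 / 2 : ℝ)..1, ∫ t in (0 : ℝ)..mass π A,
        max (t - mass π (levelSet P π A u)) 0 * w t) +
      ∫ u in (0 : ℝ)..(1 / 2), ∫ t in mass π A..1,
        max (mass π (levelSet P π A u) - t) 0 * w t := by
  have ha := mass_nonneg hπ A
  have ha1 := mass_le_one hπ A
  have e1 : Set.EqOn (fun t => ∫ u in (1 / 2 : ℝ)..1, max (t - mass π (levelSet P π A u)) 0 * w t)
      (fun t => C.revPsi P t A * w t) (Set.uIoc 0 (mass π A)) := by
    intro t ht
    rw [Set.uIoc_of_le ha] at ht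
    dsimp only
    rw [C.revPsi_of_le hP hlazy hπ A ht.1.le ht.2, intervalIntegral.integral_mul_const]
  have e2 : Set.EqOn (fun t => ∫ u in (0 : ℝ)..(1 / 2),
      max (mass π (levelSet P π A u) - t) 0 * w t)
      (fun t => C.revPsi P t A * w t) (Set.uIoc (mass π A) 1) := by
    intro t ht
    rw [Set.uIoc_of_le ha1] at ht
    dsimp only
    rw [C.revPsi_of_lt hP hlazy hπ A ht.1 ht.2, intervalIntegral.integral_mul_const]
  have i1 := (intervalIntegrable_integral_comp_levelSet P π A
    (fun t S => max (t - mass π S) 0 * w t) (1 / 2) 1 _ _ h1).congr e1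
  have i2 := (intervalIntegrable_integral_comp_levelSet P π A
    (fun t S => max (mass π S - t) 0 * w t) 0 (1 / 2) _ _ h2).congr e2
  rw [← intervalIntegral.integral_add_adjacent_intervals i1 i2,
    ← integral_integral_comp_levelSet P π A (fun t S => max (t - mass π S) 0 * w t) _ _ _ _ h1,
    ← integral_integral_comp_levelSet P π A (fun t S => max (mass π S - t) 0 * w t) _ _ _ _ h2]
  congr 1
  · exact intervalIntegral.integral_congr_ae (.of_forall fun t ht => (e1 ht).symm)
  · exact intervalIntegral.integral_congr_ae (.of_forall fun t ht => (e2 ht).symm)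

theorem intervalIntegrable_max_mul_min_left {a b : ℝ} (ha : 0 < a) (ha2 : a ≤ 1 / 2)
    (hb : 0 ≤ b) :
    IntervalIntegrable (fun t => max (t - b) 0 * (1 / (a * min t (1 - t)))) volume 0 a := by
  refine intervalIntegrable_of_abs_le (M := 1 / a) (by fun_prop) fun t ht => ?_
  rw [Set.uIoc_of_le ha.le] at ht
  have ht0 := ht.1
  rw [min_eq_left (by linarith [ht.2]), abs_of_nonneg (by positivity)]
  have : t * (1 / (a * t)) = 1 / a := by field_simp
  rw [← this]
  exact mul_le_mul_of_nonneg_right (max_le (by linarith) ht0.le) (by positivity)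

theorem intervalIntegrable_max_mul_min_right {a b : ℝ} (ha : 0 < a) (ha2 : a ≤ 1 / 2)
    (hb : b ≤ 1) :
    IntervalIntegrable (fun t => max (b - t) 0 * (1 / (a * min t (1 - t)))) volume a 1 := by
  refine intervalIntegrable_of_abs_le (M := 1 / a + 1 / a ^ 2) (by fun_prop) fun t ht => ?_
  rw [Set.uIoc_of_le (by linarith)] at ht
  have ht0 : 0 < t := ha.trans ht.1
  have ht1 : 0 ≤ 1 - t := by linarith [ht.2]
  have hmin : 0 ≤ min t (1 - t) := le_min ht0.le ht1
  rw [abs_of_nonneg (by positivity)]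
  have hle : max (b - t) 0 ≤ 1 - t := max_le (by linarith) ht1
  have h1 : 0 ≤ 1 / a := by positivity
  have h2 : 0 ≤ 1 / a ^ 2 := by positivity
  rcases min_cases t (1 - t) with ⟨h, -⟩ | ⟨h, -⟩
  · rw [h]
    have h3 : 1 / (a * t) ≤ 1 / a ^ 2 := by
      rw [pow_two]
      exact one_div_le_one_div_of_le (by positivity) (by gcongr; exact ht.1.le)
    have h4 : max (b - t) 0 * (1 / (a * t)) ≤ 1 * (1 / a ^ 2) :=
      mul_le_mul (hle.trans (by linarith)) h3 (by positivity) zero_le_one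
    linarith
  · rw [h]
    refine (mul_le_mul_of_nonneg_right hle (by positivity)).trans ?_
    rcases ht1.eq_or_lt with h0 | h0
    · rw [← h0]; simp; positivity
    · have : (1 - t) * (1 / (a * (1 - t))) = 1 / a := by field_simp
      linarith

theorem Continuization.modSpread_eq (hP : IsMarkovChain P) (hlazy : IsLazy P)
    (hπ : IsStationary P π) {A : Finset K} (hA : A.Nonempty) (hA2 : mass π A ≤ 1 / 2) :
    C.modSpread P A =
      (∫ u in (1 / 2 : ℝ)..1, ∫ t in (0 : ℝ)..mass π A,
        max (t - mass π (levelSet P π A u)) 0 * (1 / (mass π A * min t (1 - t)))) +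
      ∫ u in (0 : ℝ)..(1 / 2), ∫ t in mass π A..1,
        max (mass π (levelSet P π A u) - t) 0 * (1 / (mass π A * min t (1 - t))) := by
  have ha := mass_pos hP hπ hA
  rw [← C.integral_revPsi_mul hP hlazy hπ A (fun t => 1 / (mass π A * min t (1 - t)))
    (fun S => intervalIntegrable_max_mul_min_left ha hA2 (mass_nonneg hπ S))
    (fun S => intervalIntegrable_max_mul_min_right ha hA2 (mass_le_one hπ S))]
  simp [modSpread, div_eq_mul_inv]

theorem Continuization.glSpread_eq (hP : IsMarkovChain P) (hlazy : IsLazy P)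
    (hπ : IsStationary P π) (A : Finset K) :
    C.glSpread P A =
      (∫ u in (1 / 2 : ℝ)..1, ∫ t in (0 : ℝ)..mass π A,
        max (t - mass π (levelSet P π A u)) 0 * (1 / mass π A ^ 2)) +
      ∫ u in (0 : ℝ)..(1 / 2), ∫ t in mass π A..1,
        max (mass π (levelSet P π A u) - t) 0 * (1 / mass π A ^ 2) := by
  rw [← C.integral_revPsi_mul hP hlazy hπ A (fun t => 1 / mass π A ^ 2)
    (fun S => Continuous.intervalIntegrable (by fun_prop) _ _)
    (fun S => Continuous.intervalIntegrable (by fun_prop) _ _)]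
  simp [glSpread, div_eq_mul_inv]

theorem Continuization.half_modSpread_le_glSpread (hP : IsMarkovChain P) (hlazy : IsLazy P)
    (hπ : IsStationary P π) {A : Finset K} (hA : A.Nonempty) (hA2 : mass π A ≤ 1 / 2) :
    1 / 2 * C.modSpread P A ≤ C.glSpread P A := by
  have ha := mass_pos hP hπ hA
  rw [C.modSpread_eq hP hlazy hπ hA hA2, C.glSpread_eq hP hlazy hπ, mul_add,
    ← intervalIntegral.integral_const_mul, ← intervalIntegral.integral_const_mul]
  refine add_le_add ?_ ?_
  · refine intervalIntegral.integral_mono_on (by norm_num)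
      (intervalIntegrable_comp_levelSet P π A (fun S => 1 / 2 * ∫ t in (0 : ℝ)..mass π A,
        max (t - mass π S) 0 * (1 / (mass π A * min t (1 - t)))) _ _)
      (intervalIntegrable_comp_levelSet P π A (fun S => ∫ t in (0 : ℝ)..mass π A,
        max (t - mass π S) 0 * (1 / mass π A ^ 2)) _ _) fun u _ => ?_
    exact half_integral_min_le ha hA2 (mass_nonneg hπ _) le_rfl (by linarith)
  · refine intervalIntegral.integral_mono_on (by norm_num)
      (intervalIntegrable_comp_levelSet P π A (fun S => 1 / 2 * ∫ t in mass π A..1,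
        max (mass π S - t) 0 * (1 / (mass π A * min t (1 - t)))) _ _)
      (intervalIntegrable_comp_levelSet P π A (fun S => ∫ t in mass π A..1,
        max (mass π S - t) 0 * (1 / mass π A ^ 2)) _ _) fun u _ => ?_
    -- The reflection `t ↦ 1 - t` preserves `min t (1 - t)` and turns the range above `π(A)` into
    -- the same estimate with `c = 1 - π(A_u)`.
    have h := half_integral_min_le (T := 1 - mass π A) ha hA2
      (sub_nonneg.2 (mass_le_one hπ (levelSet P π A u))) (by linarith) le_rfl
    have s1 := intervalIntegral.integral_comp_sub_left (a := 0) (b := 1 - mass π A) (fun t =>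
      max (mass π (levelSet P π A u) - t) 0 * (1 / (mass π A * min t (1 - t)))) 1
    have s2 := intervalIntegral.integral_comp_sub_left (a := 0) (b := 1 - mass π A) (fun t =>
      max (mass π (levelSet P π A u) - t) 0 * (1 / mass π A ^ 2)) 1
    rw [sub_sub_cancel, sub_zero] at s1 s2
    rw [← s1, ← s2]
    convert h using 4 with s s
    · rw [sub_sub_cancel, min_comm]
      congr 2
      ring
    · ring_nf

/-- Bounding `min t (1 - t)` by `t` leaves the integrals that produce the entropy `x log x - (x -
1)`, which dominates `2(1 - √x)` up to a linear term of mean zero. -/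
theorem Continuization.evoSpread_le_half_modSpread (hP : IsMarkovChain P) (hlazy : IsLazy P)
    (hπ : IsStationary P π) {A : Finset K} (hA : A.Nonempty) (hA2 : mass π A ≤ 1 / 2) :
    evoSpread P π A ≤ 1 / 2 * C.modSpread P A := by
  have ha := mass_pos hP hπ hA
  set a := mass π A with ha_def
  have hi := fun (φ : ℝ → ℝ) c d =>
    intervalIntegrable_comp_levelSet P π A (fun S => φ (mass π S)) c d
  have hlow : ∫ u in (0 : ℝ)..1, (1 / a * (mass π (levelSet P π A u) *
      Real.log (mass π (levelSet P π A u) / a) - (mass π (levelSet P π A u) - a))) ≤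
      C.modSpread P A := by
    rw [C.modSpread_eq hP hlazy hπ hA hA2, add_comm,
      ← intervalIntegral.integral_add_adjacent_intervals
        (hi (fun b => 1 / a * (b * Real.log (b / a) - (b - a))) 0 (1 / 2))
        (hi (fun b => 1 / a * (b * Real.log (b / a) - (b - a))) (1 / 2) 1)]
    refine add_le_add ?_ ?_
    · refine intervalIntegral.integral_mono_on_of_le_Ioo (by norm_num)
        (hi (fun b => 1 / a * (b * Real.log (b / a) - (b - a))) _ _)
        (hi (fun b => ∫ t in a..1, max (b - t) 0 * (1 / (a * min t (1 - t)))) _ _) fun u hu => ?_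
      have hb := mass_mono hπ (subset_levelSet hP hlazy hπ A hu.2)
      have hb1 := mass_le_one hπ (levelSet P π A u)
      refine (mul_le_mul_of_nonneg_left (mul_log_sub_le_integral_right ha hb hb1)
        (by positivity)).trans ?_
      rw [← intervalIntegral.integral_const_mul]
      refine intervalIntegral.integral_mono_on_of_le_Ioo (by linarith)
        (ContinuousOn.intervalIntegrable (ContinuousOn.mul continuousOn_const
          (ContinuousOn.div (by fun_prop) (by fun_prop) fun t ht => ?_)))
        (intervalIntegrable_max_mul_min_right ha hA2 hb1) fun t ht => ?_
      · rw [Set.uIcc_of_le (by linarith)] at ht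
        exact (ha.trans_le ht.1).ne'
      · have ht0 : 0 < t := ha.trans ht.1
        have hmin : 0 < min t (1 - t) := lt_min ht0 (by linarith [ht.2])
        have e : 1 / a * (max (mass π (levelSet P π A u) - t) 0 / t) =
            max (mass π (levelSet P π A u) - t) 0 * (1 / (a * t)) := by field_simp
        rw [e]
        refine mul_le_mul_of_nonneg_left (one_div_le_one_div_of_le (by positivity) ?_)
          (le_max_right _ _)
        gcongr
        exact min_le_left _ _
    · refine intervalIntegral.integral_mono_on (by norm_num)
        (hi (fun b => 1 / a * (b * Real.log (b / a) - (b - a))) _ _)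
        (hi (fun b => ∫ t in (0 : ℝ)..a, max (t - b) 0 * (1 / (a * min t (1 - t)))) _ _)
        fun u hu => ?_
      have hb := mass_mono hπ (levelSet_subset hP hlazy hπ A hu.1)
      refine (mul_le_mul_of_nonneg_left (mul_log_sub_le_integral_left ha (mass_nonneg hπ _) hb)
        (by positivity)).trans (le_of_eq ?_)
      rw [← intervalIntegral.integral_const_mul]
      refine intervalIntegral.integral_congr fun t ht => ?_
      rw [Set.uIcc_of_le ha.le] at ht
      rw [min_eq_left (by linarith [ht.2]), ← ha_def]
      field_simp
  have h0 := integral_one_sub_levelSet_mass hP hπ hA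
  have hmono : evoSpread P π A + 1 / 2 * -(∫ u in (0 : ℝ)..1,
      (1 - mass π (levelSet P π A u) / a)) ≤
      1 / 2 * ∫ u in (0 : ℝ)..1, (1 / a * (mass π (levelSet P π A u) *
      Real.log (mass π (levelSet P π A u) / a) - (mass π (levelSet P π A u) - a))) := by
    rw [evoSpread_eq_integral, ← intervalIntegral.integral_neg,
      ← intervalIntegral.integral_const_mul, ← intervalIntegral.integral_const_mul,
      ← intervalIntegral.integral_add (hi (fun b => 1 - √(b / a)) _ _)
        (hi (fun b => 1 / 2 * -(1 - b / a)) _ _)]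
    refine intervalIntegral.integral_mono_on (by norm_num)
      (hi (fun b => 1 - √(b / a) + 1 / 2 * -(1 - b / a)) _ _)
      (hi (fun b => 1 / 2 * (1 / a * (b * Real.log (b / a) - (b - a)))) _ _) fun u _ => ?_
    have h := one_sub_sqrt_le_mul_log (levelSet_mass_div_nonneg hπ A u)
    have e : 1 / a * (mass π (levelSet P π A u) *
        Real.log (mass π (levelSet P π A u) / a) - (mass π (levelSet P π A u) - a)) =
        mass π (levelSet P π A u) / a * Real.log (mass π (levelSet P π A u) / a) -
          (mass π (levelSet P π A u) / a - 1) := by field_simp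
    rw [e]
    linarith
  rw [h0] at hmono
  linarith

end

/-! ### The evolving set process -/

section

variable {K : Type*} [Fintype K]

/-- The transition matrix of the evolving set process. -/
noncomputable def evolve (P : Matrix K K ℝ) (π : K → ℝ) : Matrix (Finset K) (Finset K) ℝ :=
  fun A S => levelWeight P π A 0 1 S

/-- The `L²(π)` norm of the centred indicator of `S`. -/
noncomputable def spreadNorm (π : K → ℝ) (S : Finset K) : ℝ := √(mass π S * (1 - mass π S))

/-- Use `√(1 + z) ≤ 1 + z/2` on `(1 - b)/(1 - a)`, then drop the factor `√(b/a)` from the correction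
because `(√(b/a) - 1)(b - a) ≥ 0`. The correction left is linear in `b` and averages to zero. -/
theorem sqrt_mul_one_sub_le {a b : ℝ} (ha : 0 < a) (ha1 : a < 1) (hb : 0 ≤ b) (hb1 : b ≤ 1) :
    √(b * (1 - b)) ≤ √(a * (1 - a)) * (√(b / a) - (b - a) / (2 * (1 - a))) := by
  have ha1' : 0 < 1 - a := by linarith
  have e : b * (1 - b) = a * (1 - a) * (b / a * ((1 - b) / (1 - a))) := by field_simp
  have hab : 0 ≤ a * (1 - a) := by positivity
  have hba : 0 ≤ b / a := by positivity
  rw [e, Real.sqrt_mul hab, Real.sqrt_mul hba]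
  refine mul_le_mul_of_nonneg_left ?_ (Real.sqrt_nonneg _)
  have hy : √((1 - b) / (1 - a)) ≤ 1 - (b - a) / (2 * (1 - a)) := by
    have e2 : (1 - b) / (1 - a) = 1 + -((b - a) / (1 - a)) := by
      field_simp
      ring
    rw [e2]
    refine (Real.sqrt_one_add_le ?_).trans (le_of_eq ?_)
    · rw [neg_le_neg_iff, div_le_one ha1']
      linarith
    · field_simp
      ring
  have h1 := mul_le_mul_of_nonneg_left hy (Real.sqrt_nonneg (b / a))
  have h2 : 0 ≤ (√(b / a) - 1) * ((b - a) / (2 * (1 - a))) := by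
    rcases le_total a b with h | h
    · refine mul_nonneg (sub_nonneg.2 (Real.one_le_sqrt.2 ((one_le_div ha).2 h)))
        (div_nonneg (by linarith) (by linarith))
    · refine mul_nonneg_of_nonpos_of_nonpos (sub_nonpos.2 (Real.sqrt_le_one.2
        ((div_le_one ha).2 h))) (div_nonpos_of_nonpos_of_nonneg (by linarith) (by linarith))
  nlinarith

variable {P : Matrix K K ℝ} {π : K → ℝ}

theorem minMass_le (hπ : IsStationary P π) (x : K) : minMass π ≤ π x :=
  ciInf_le ⟨0, by rintro _ ⟨v, rfl⟩; exact hπ.mem_stdSimplex.1 v⟩ x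

theorem exists_eq_minMass (hπ : IsStationary P π) : ∃ x, π x = minMass π := by
  have : Nonempty K := by
    by_contra h
    rw [not_nonempty_iff] at h
    have := hπ.mem_stdSimplex.2
    simp at this
  exact exists_eq_ciInf_of_finite

theorem chiSqDist_eq_norm_sq (hπ : ∀ v, 0 ≤ π v) (q : K → ℝ) :
    chiSqDist q π = ‖WithLp.toLp 2 (fun v => √(π v) * (q v / π v - 1))‖ ^ 2 := by
  rw [EuclideanSpace.norm_sq_eq, chiSqDist]
  refine Finset.sum_congr rfl fun v _ => ?_
  simp only [Real.norm_eq_abs, sq_abs, mul_pow, Real.sq_sqrt (hπ v)]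
  ring

theorem integral_spreadNorm_empty (P : Matrix K K ℝ) (π : K → ℝ) :
    ∫ u in (0 : ℝ)..1, spreadNorm π (levelSet P π ∅ u) = 0 := by
  rw [intervalIntegral.integral_congr (g := fun _ => (0 : ℝ))]
  · simp
  · intro u hu
    rw [Set.uIcc_of_le zero_le_one] at hu
    have : levelSet P π ∅ u = ∅ := by
      ext y
      simp [mem_levelSet, entry, hu.1]
    simp [this, spreadNorm, mass]

variable [DecidableEq K]

/-- The expectation of `φ` after `n` steps of the evolving set process started from `A`. -/
noncomputable def evoExp (P : Matrix K K ℝ) (π : K → ℝ) (A : Finset K) (n : ℕ)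
    (φ : Finset K → ℝ) : ℝ := ∑ S, (evolve P π ^ n) A S * φ S

theorem evoExp_zero (A : Finset K) (φ : Finset K → ℝ) : evoExp P π A 0 φ = φ A := by
  simp [evoExp, Matrix.one_apply]

theorem evoExp_succ (A : Finset K) (n : ℕ) (φ : Finset K → ℝ) :
    evoExp P π A (n + 1) φ =
      evoExp P π A n fun S => ∫ u in (0 : ℝ)..1, φ (levelSet P π S u) := by
  simp only [evoExp, pow_succ, Matrix.mul_apply, integral_comp_levelSet, Finset.sum_mul,
    Finset.mul_sum, evolve]
  rw [Finset.sum_comm]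
  simp_rw [mul_assoc]

theorem evolve_pow_nonneg (n : ℕ) (A S : Finset K) : 0 ≤ (evolve P π ^ n) A S := by
  induction n generalizing S with
  | zero => rw [pow_zero, Matrix.one_apply]; split_ifs <;> norm_num
  | succ n ih =>
    rw [pow_succ, Matrix.mul_apply]
    exact Finset.sum_nonneg fun T _ =>
      mul_nonneg (ih T) (levelWeight_nonneg P π T S zero_le_one)

theorem evoExp_mono (A : Finset K) (n : ℕ) {φ χ : Finset K → ℝ} (h : ∀ S, φ S ≤ χ S) :
    evoExp P π A n φ ≤ evoExp P π A n χ :=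
  Finset.sum_le_sum fun S _ => mul_le_mul_of_nonneg_left (h S) (evolve_pow_nonneg n A S)

theorem evoExp_const_mul (A : Finset K) (n : ℕ) (c : ℝ) (φ : Finset K → ℝ) :
    evoExp P π A n (fun S => c * φ S) = c * evoExp P π A n φ := by
  rw [evoExp, evoExp, Finset.mul_sum]
  exact Finset.sum_congr rfl fun S _ => by ring

theorem evoExp_sub (A : Finset K) (n : ℕ) (φ χ : Finset K → ℝ) :
    evoExp P π A n (fun S => φ S - χ S) = evoExp P π A n φ - evoExp P π A n χ := by
  rw [evoExp, evoExp, evoExp, ← Finset.sum_sub_distrib]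
  exact Finset.sum_congr rfl fun S _ => by ring

theorem evoExp_mass (hP : IsMarkovChain P) (hπ : IsStationary P π) (A : Finset K) (n : ℕ) :
    evoExp P π A n (mass π) = mass π A := by
  induction n with
  | zero => exact evoExp_zero A _
  | succ n ih =>
    rw [evoExp_succ]
    simp_rw [integral_mass_levelSet hP hπ]
    exact ih

/-- Membership in the evolving set has the law of the time reversal. -/
theorem evoExp_mem (hP : IsMarkovChain P) (hπ : IsStationary P π) (x : K) (n : ℕ) (y : K) :
    evoExp P π {x} n (fun S => if y ∈ S then 1 else 0) = π x * (P ^ n) x y / π y := by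
  induction n generalizing y with
  | zero =>
    rw [evoExp_zero, pow_zero, Matrix.one_apply]
    by_cases h : y = x
    · subst h
      simp [(hπ.pos hP y).ne']
    · simp [h, Ne.symm h]
  | succ n ih =>
    rw [evoExp_succ]
    simp_rw [integral_levelSet_indicator hP hπ]
    have h : ∀ S : Finset K, entry P π S y =
        ∑ z, reversal P π y z * (if z ∈ S then 1 else 0) := fun S => by simp [entry]
    simp_rw [evoExp, h, Finset.mul_sum]
    rw [Finset.sum_comm]
    have h2 : ∀ z, ∑ S, (evolve P π ^ n) {x} S * (reversal P π y z * (if z ∈ S then 1 else 0)) =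
        reversal P π y z * (π x * (P ^ n) x z / π z) := by
      intro z
      rw [← ih z, evoExp, Finset.mul_sum]
      exact Finset.sum_congr rfl fun S _ => by ring
    simp_rw [h2]
    rw [pow_succ, Matrix.mul_apply, Finset.mul_sum, Finset.sum_div]
    refine Finset.sum_congr rfl fun z _ => ?_
    have hz := (hπ.pos hP z).ne'
    rw [reversal]
    field_simp

theorem norm_centred_indicator (hπ : IsStationary P π) (S : Finset K) :
    ‖WithLp.toLp 2 (fun v => √(π v) * ((if v ∈ S then 1 else 0) - mass π S))‖ =
      spreadNorm π S := by
  rw [EuclideanSpace.norm_eq, spreadNorm]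
  congr 1
  have h : ∀ v, ‖√(π v) * ((if v ∈ S then 1 else 0) - mass π S)‖ ^ 2 =
      (1 - 2 * mass π S) * (π v * (if v ∈ S then 1 else 0)) + mass π S ^ 2 * π v := by
    intro v
    rw [Real.norm_eq_abs, sq_abs, mul_pow, Real.sq_sqrt (hπ.mem_stdSimplex.1 v)]
    split_ifs <;> ring
  simp only [h]
  rw [Finset.sum_add_distrib, ← Finset.mul_sum, ← Finset.mul_sum, ← mass_eq_sum_ite,
    hπ.mem_stdSimplex.2]
  ring

/-- The density minus one is a mixture of centred indicators of evolving sets, and the triangle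
inequality in `L²(π)` applies twice: over starting states and over sets. -/
theorem chiSqDist_le (hP : IsMarkovChain P) (hπ : IsStationary P π) {p : K → ℝ}
    (hp : p ∈ stdSimplex ℝ K) (n : ℕ) {δ : ℝ}
    (h : ∀ x, evoExp P π {x} n (spreadNorm π) ≤ δ * π x) :
    chiSqDist (p ᵥ* P ^ n) π ≤ δ ^ 2 := by
  rw [chiSqDist_eq_norm_sq fun v => (hπ.pos hP v).le]
  have e : WithLp.toLp 2 (fun v => √(π v) * ((p ᵥ* P ^ n) v / π v - 1)) =
      ∑ x, (p x / π x) • ∑ S, (evolve P π ^ n) {x} S •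
        WithLp.toLp 2 (fun v => √(π v) * ((if v ∈ S then 1 else 0) - mass π S)) := by
    ext v
    have h1 : ∀ x, ∑ S, (evolve P π ^ n) {x} S *
        (√(π v) * ((if v ∈ S then 1 else 0) - mass π S)) =
        √(π v) * (π x * (P ^ n) x v / π v - π x) := by
      intro x
      rw [← evoExp_mem hP hπ x n v]
      conv_rhs => rw [← show mass π {x} = π x by simp [mass], ← evoExp_mass hP hπ {x} n]
      rw [← evoExp_sub, ← evoExp_const_mul]
      rfl
    simp only [WithLp.ofLp_sum, WithLp.ofLp_smul, Finset.sum_apply, Pi.smul_apply, smul_eq_mul,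
      h1]
    have h2 : ∀ x, p x / π x * (√(π v) * (π x * (P ^ n) x v / π v - π x)) =
        √(π v) * (p x * (P ^ n) x v / π v - p x) := by
      intro x
      have := (hπ.pos hP x).ne'
      field_simp
    simp_rw [h2]
    rw [← Finset.mul_sum, Finset.sum_sub_distrib, ← Finset.sum_div, hp.2]
    rfl
  rw [e]
  refine pow_le_pow_left₀ (norm_nonneg _) ?_ 2
  refine (norm_sum_le _ _).trans ?_
  have hδp : δ = ∑ x, δ * p x := by rw [← Finset.mul_sum, hp.2, mul_one]
  rw [hδp]
  refine Finset.sum_le_sum fun x _ => ?_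
  have hx := hπ.pos hP x
  rw [norm_smul, Real.norm_of_nonneg (div_nonneg (hp.1 x) hx.le)]
  have h3 : ‖∑ S, (evolve P π ^ n) {x} S •
      WithLp.toLp 2 (fun v => √(π v) * ((if v ∈ S then 1 else 0) - mass π S))‖ ≤ δ * π x := by
    refine (norm_sum_le _ _).trans (le_trans (le_of_eq ?_) (h x))
    refine Finset.sum_congr rfl fun S _ => ?_
    rw [norm_smul, Real.norm_of_nonneg (evolve_pow_nonneg n {x} S), norm_centred_indicator hπ]
  refine (mul_le_mul_of_nonneg_left h3 (div_nonneg (hp.1 x) hx.le)).trans (le_of_eq ?_)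
  field_simp

theorem spreadNorm_compl (hπ : IsStationary P π) (S : Finset K) :
    spreadNorm π Sᶜ = spreadNorm π S := by
  rw [spreadNorm, spreadNorm, mass_compl hπ]
  congr 1
  ring

theorem integral_spreadNorm_compl (hP : IsMarkovChain P) (hπ : IsStationary P π) (S : Finset K) :
    ∫ u in (0 : ℝ)..1, spreadNorm π (levelSet P π Sᶜ u) =
      ∫ u in (0 : ℝ)..1, spreadNorm π (levelSet P π S u) := by
  rw [integral_comp_levelSet_compl hP hπ S (spreadNorm π)]
  simp [spreadNorm_compl hπ]

theorem mass_lt_one (hP : IsMarkovChain P) (hπ : IsStationary P π) {A : Finset K}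
    (hA : A ≠ Finset.univ) : mass π A < 1 := by
  have h : (Aᶜ).Nonempty := by
    rwa [Finset.nonempty_iff_ne_empty, Ne, Finset.compl_eq_empty_iff]
  linarith [mass_pos hP hπ h, mass_compl hπ A]

theorem integral_spreadNorm_le (hP : IsMarkovChain P) (hπ : IsStationary P π) {S : Finset K}
    (hS : S.Nonempty) (hS1 : S ≠ Finset.univ) :
    ∫ u in (0 : ℝ)..1, spreadNorm π (levelSet P π S u) ≤
      (1 - evoSpread P π S) * spreadNorm π S := by
  have ha := mass_pos hP hπ hS
  have ha1 := mass_lt_one hP hπ hS1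
  have hi := fun (φ : ℝ → ℝ) =>
    intervalIntegrable_comp_levelSet P π S (fun S => φ (mass π S)) 0 1
  have h := intervalIntegral.integral_mono_on zero_le_one
    (hi (fun b => √(b * (1 - b))))
    (hi (fun b => √(mass π S * (1 - mass π S)) * (√(b / mass π S) -
      (b - mass π S) / (2 * (1 - mass π S)))))
    fun u _ => sqrt_mul_one_sub_le ha ha1 (mass_nonneg hπ (levelSet P π S u))
      (mass_le_one hπ _)
  refine h.trans (le_of_eq ?_)
  rw [intervalIntegral.integral_const_mul, intervalIntegral.integral_sub
    (hi (fun b => √(b / mass π S))) (hi (fun b => (b - mass π S) / (2 * (1 - mass π S)))),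
    intervalIntegral.integral_div, intervalIntegral.integral_sub (hi (fun b => b))
    intervalIntegrable_const, integral_mass_levelSet hP hπ, evoSpread, spreadNorm]
  simp
  ring

/-- Otherwise nothing flows from `Aᶜ` into `A`, and no power of `P` leads there, against
irreducibility. -/
theorem exists_entry_lt_one (hP : IsMarkovChain P) (hπ : IsStationary P π) {A : Finset K}
    (hA : A.Nonempty) (hA1 : A ≠ Finset.univ) : ∃ y ∈ A, entry P π A y < 1 := by
  by_contra! h
  have hz : ∀ x ∉ A, ∀ y ∈ A, P x y = 0 := by
    intro x hx y hy
    have h1 : entry P π Aᶜ y = 0 :=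
      le_antisymm (by linarith [entry_compl hP hπ A y, h y hy]) (entry_nonneg hP hπ _ _)
    have h2 := (Finset.sum_eq_zero_iff_of_nonneg fun z _ => div_nonneg
      (mul_nonneg (hπ.pos hP z).le (hP.nonneg z y)) (hπ.pos hP y).le).1 h1 x
      (Finset.mem_compl.2 hx)
    simpa [(hπ.pos hP x).ne', (hπ.pos hP y).ne'] using h2
  obtain ⟨x, hx⟩ : ∃ x, x ∉ A := by
    by_contra! hall
    exact hA1 (Finset.eq_univ_iff_forall.2 hall)
  obtain ⟨y, hy⟩ := hA
  have hpow : ∀ t : ℕ, ∀ z ∈ A, (P ^ t) x z = 0 := by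
    intro t
    induction t with
    | zero =>
      intro z hz
      rw [pow_zero, Matrix.one_apply_ne]
      rintro rfl
      exact hx hz
    | succ t ih =>
      intro z hzA
      rw [pow_succ, Matrix.mul_apply]
      refine Finset.sum_eq_zero fun w _ => ?_
      by_cases hw : w ∈ A
      · rw [ih w hw, zero_mul]
      · rw [hz w hw z hzA, mul_zero]
  obtain ⟨t, ht⟩ := hP.irreducible x y
  exact ht.ne' (hpow t y hy)

/-! ### The spread profile and the one-step contraction. -/

variable (C : Continuization π)

theorem Continuization.spread_nonneg (hP : IsMarkovChain P) (hlazy : IsLazy P)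
    (hπ : IsStationary P π) {A : Finset K} (hA : A.Nonempty) : 0 ≤ C.spread P A := by
  rw [C.spread_eq hP hlazy hπ hA]
  exact intervalIntegral.integral_nonneg (by norm_num) fun u _ => by positivity

theorem Continuization.spread_pos (hP : IsMarkovChain P) (hlazy : IsLazy P)
    (hπ : IsStationary P π) {A : Finset K} (hA : A.Nonempty) (hA1 : A ≠ Finset.univ) :
    0 < C.spread P A := by
  obtain ⟨y, hy, hy1⟩ := exists_entry_lt_one hP hπ hA hA1
  have ha := mass_pos hP hπ hA
  have hyp := hπ.pos hP y
  have hc := half_le_entry hP hlazy hπ hy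
  have hi := fun c d => intervalIntegrable_comp_levelSet P π A
    (fun S => (1 - mass π S / mass π A) ^ 2 / 2) c d
  rw [C.spread_eq hP hlazy hπ hA,
    ← intervalIntegral.integral_add_adjacent_intervals (hi _ (entry P π A y)) (hi _ _)]
  refine add_pos_of_nonneg_of_pos
    (intervalIntegral.integral_nonneg hc fun u _ => by positivity) ?_
  -- Above the level `entry P π A y < 1` the state `y` has left the set, so the relative loss is at
  -- least `π(y)/π(A)`.
  have h := intervalIntegral.integral_mono_on hy1.le
    (intervalIntegrable_const (c := (π y / mass π A) ^ 2 / 2)) (hi (entry P π A y) 1) fun u hu => by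
      have hsub : levelSet P π A u ⊆ A.erase y := by
        intro z hz
        refine Finset.mem_erase.2 ⟨?_, levelSet_subset hP hlazy hπ A (hc.trans hu.1) hz⟩
        rintro rfl
        exact not_lt.2 hu.1 (mem_levelSet.1 hz)
      have h1 := mass_mono hπ hsub
      have h2 : mass π (A.erase y) + π y = mass π A := Finset.sum_erase_add A π hy
      have h3 : π y / mass π A ≤ 1 - mass π (levelSet P π A u) / mass π A := by
        rw [le_sub_iff_add_le, ← add_div, div_le_one ha]
        linarith
      gcongr
  refine lt_of_lt_of_le ?_ h
  rw [intervalIntegral.integral_const, smul_eq_mul]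
  exact mul_pos (by linarith) (by positivity)

theorem Continuization.spreadProfile_le (hP : IsMarkovChain P) (hlazy : IsLazy P)
    (hπ : IsStationary P π) {A : Finset K} (hA : A.Nonempty) {x : ℝ} (hx : mass π A ≤ x) :
    C.spreadProfile P x ≤ C.spread P A :=
  csInf_le ⟨0, by rintro _ ⟨B, hB, -, rfl⟩; exact C.spread_nonneg hP hlazy hπ hB⟩
    ⟨A, hA, hx, rfl⟩

/-- The infimum runs over finitely many sets, and the smallest state makes the family nonempty. -/
theorem Continuization.exists_spreadProfile_eq (hπ : IsStationary P π) {x : ℝ}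
    (hx : minMass π ≤ x) :
    ∃ A : Finset K, A.Nonempty ∧ mass π A ≤ x ∧ C.spreadProfile P x = C.spread P A := by
  obtain ⟨v, hv⟩ := exists_eq_minMass hπ
  have hne : {r | ∃ A : Finset K, A.Nonempty ∧ mass π A ≤ x ∧ r = C.spread P A}.Nonempty :=
    ⟨_, {v}, Finset.singleton_nonempty v, by simpa [mass, hv] using hx, rfl⟩
  have hfin : {r | ∃ A : Finset K, A.Nonempty ∧ mass π A ≤ x ∧ r = C.spread P A}.Finite := by
    refine (Set.finite_range (C.spread P)).subset ?_
    rintro _ ⟨A, -, -, rfl⟩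
    exact ⟨A, rfl⟩
  exact hne.csInf_mem hfin

theorem Continuization.spreadProfile_pos (hP : IsMarkovChain P) (hlazy : IsLazy P)
    (hπ : IsStationary P π) {x : ℝ} (hx : minMass π ≤ x) (hx1 : x < 1) :
    0 < C.spreadProfile P x := by
  obtain ⟨A, hA, hAx, h⟩ := C.exists_spreadProfile_eq (P := P) hπ hx
  rw [h]
  refine C.spread_pos hP hlazy hπ hA ?_
  rintro rfl
  linarith [mass_univ hπ]

theorem Continuization.spreadProfile_le_quarter (hP : IsMarkovChain P) (hlazy : IsLazy P)
    (hπ : IsStationary P π) {x : ℝ} (hx : minMass π ≤ x) : C.spreadProfile P x ≤ 1 / 4 := by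
  obtain ⟨A, hA, -, h⟩ := C.exists_spreadProfile_eq (P := P) hπ hx
  rw [h]
  exact C.spread_le_quarter hP hlazy hπ hA

theorem Continuization.spreadProfile_anti (hP : IsMarkovChain P) (hlazy : IsLazy P)
    (hπ : IsStationary P π) {x y : ℝ} (hx : minMass π ≤ x) (hxy : x ≤ y) :
    C.spreadProfile P y ≤ C.spreadProfile P x := by
  obtain ⟨A, hA, hAx, h⟩ := C.exists_spreadProfile_eq (P := P) hπ hx
  rw [h]
  exact C.spreadProfile_le hP hlazy hπ hA (hAx.trans hxy)

/-- A set of mass above one half is replaced by its complement, which has the same norm and the same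
expected norm after one step. -/
theorem Continuization.integral_spreadNorm_le_profile (hP : IsMarkovChain P) (hlazy : IsLazy P)
    (hπ : IsStationary P π) (S : Finset K) :
    ∫ u in (0 : ℝ)..1, spreadNorm π (levelSet P π S u) ≤
      (1 - C.spreadProfile P (min (mass π S) (1 / 2)) / 4) * spreadNorm π S := by
  rcases S.eq_empty_or_nonempty with rfl | hS
  · rw [integral_spreadNorm_empty]
    simp [spreadNorm, mass]
  by_cases hS1 : S = Finset.univ
  · subst hS1
    rw [← integral_spreadNorm_compl hP hπ, Finset.compl_univ, integral_spreadNorm_empty]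
    simp [spreadNorm, mass_univ hπ]
  have key : ∀ T : Finset K, T.Nonempty → T ≠ Finset.univ → ∀ x, mass π T ≤ x →
      ∫ u in (0 : ℝ)..1, spreadNorm π (levelSet P π T u) ≤
        (1 - C.spreadProfile P x / 4) * spreadNorm π T := by
    intro T hT hT1 x hx
    refine (integral_spreadNorm_le hP hπ hT hT1).trans
      (mul_le_mul_of_nonneg_right ?_ (Real.sqrt_nonneg _))
    linarith [C.quarter_spread_le_evoSpread hP hlazy hπ hT, C.spreadProfile_le hP hlazy hπ hT hx]
  rcases le_total (mass π S) (1 / 2) with h | h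
  · rw [min_eq_left h]
    exact key S hS hS1 _ le_rfl
  · rw [min_eq_right h, ← integral_spreadNorm_compl hP hπ, ← spreadNorm_compl hπ S]
    refine key Sᶜ ?_ ?_ _ (by rw [mass_compl hπ]; linarith)
    · rwa [Finset.nonempty_iff_ne_empty, Ne, Finset.compl_eq_empty_iff]
    · rwa [Ne, Finset.compl_eq_univ_iff, ← Ne, ← Finset.nonempty_iff_ne_empty]

theorem Continuization.integral_spreadNorm_singleton_le (hP : IsMarkovChain P)
    (hlazy : IsLazy P) (hπ : IsStationary P π) {x : K} (hx : π x ≤ 1 / 2) :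
    ∫ u in (0 : ℝ)..1, spreadNorm π (levelSet P π {x} u) ≤
      (1 - C.spreadProfile P (1 / 2)) * spreadNorm π {x} := by
  have hm : mass π {x} = π x := by simp [mass]
  refine (integral_spreadNorm_le hP hπ (Finset.singleton_nonempty x) ?_).trans
    (mul_le_mul_of_nonneg_right ?_ (Real.sqrt_nonneg _))
  · intro h
    have := mass_univ hπ
    rw [← h, hm] at this
    linarith
  · linarith [C.spread_singleton_le_evoSpread hP hlazy hπ x,
      C.spreadProfile_le hP hlazy hπ (Finset.singleton_nonempty x) (hm.le.trans hx)]

end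

/-! ### Mixing times -/

section

theorem spreadNorm_singleton {K : Type*} {π : K → ℝ} (x : K) :
    spreadNorm π {x} = √(π x * (1 - π x)) := by
  simp [spreadNorm, mass]

variable {K : Type*} [Fintype K] {P : Matrix K K ℝ} {π : K → ℝ}

/-- Cauchy–Schwarz in the form `4ε|f| ≤ f² + 4ε²`, summed against `π`. -/
theorem tvDist_le_of_chiSqDist_le (hπ : π ∈ stdSimplex ℝ K) {p : K → ℝ} {ε : ℝ} (hε : 0 < ε)
    (h : chiSqDist p π ≤ 4 * ε ^ 2) : tvDist p π ≤ ε := by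
  have h1 : 4 * ε * ∑ v, |p v / π v - 1| * π v ≤ chiSqDist p π + 4 * ε ^ 2 * ∑ v, π v := by
    rw [chiSqDist, Finset.mul_sum, Finset.mul_sum, ← Finset.sum_add_distrib]
    refine Finset.sum_le_sum fun v _ => ?_
    have := mul_nonneg (sq_nonneg (|p v / π v - 1| - 2 * ε)) (hπ.1 v)
    linarith
  rw [hπ.2, mul_one] at h1
  have h2 : ε * tvDist p π ≤ ε * ε := by
    rw [tvDist]
    linarith
  exact le_of_mul_le_mul_left h2 hε

variable [DecidableEq K]

theorem tvMixingTime_le_chiSqMixingTime (hπ : π ∈ stdSimplex ℝ K) {ε : ℝ} (hε : 0 < ε) :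
    tvMixingTime P π ε ≤ chiSqMixingTime P π (4 * ε ^ 2) :=
  iSup₂_mono fun _ _ => biInf_mono fun _ ht => tvDist_le_of_chiSqDist_le hπ hε ht

theorem worstTime_le {d : (K → ℝ) → (K → ℝ) → ℝ} {ε : ℝ} {n : ℕ}
    (h : ∀ p ∈ stdSimplex ℝ K, d (p ᵥ* P ^ n) π ≤ ε) : worstTime d P π ε ≤ n :=
  iSup₂_le fun p hp => iInf₂_le n (h p hp)

/-- No ceiling is allowed in the bounds, so the estimate must already hold at time `⌊R⌋`, where only
`R < ⌊R⌋ + 1` is known. -/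
theorem coe_chiSqMixingTime_le (hP : IsMarkovChain P) (hπ : IsStationary P π) {ε R : ℝ}
    (hR : 0 ≤ R)
    (h : ∀ x, evoExp P π {x} ⌊R⌋₊ (spreadNorm π) ≤ 2 * ε * π x) :
    (((chiSqMixingTime P π (4 * ε ^ 2) : ℕ∞) : ℝ≥0∞) : EReal) ≤ ((R : ℝ) : EReal) := by
  have h1 : chiSqMixingTime P π (4 * ε ^ 2) ≤ (⌊R⌋₊ : ℕ∞) := worstTime_le fun p hp => by
    refine (chiSqDist_le hP hπ hp ⌊R⌋₊ h).trans (le_of_eq ?_)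
    ring
  have h2 : (((chiSqMixingTime P π (4 * ε ^ 2) : ℕ∞) : ℝ≥0∞) : EReal) ≤
      ((((⌊R⌋₊ : ℕ) : ℕ∞) : ℝ≥0∞) : EReal) := by
    exact_mod_cast h1
  refine h2.trans ?_
  have h3 : ((((⌊R⌋₊ : ℕ) : ℕ∞) : ℝ≥0∞) : EReal) = (((⌊R⌋₊ : ℕ) : ℝ) : EReal) := by
    rw [ENat.toENNReal_coe]
    rfl
  rw [h3]
  exact_mod_cast Nat.floor_le hR

theorem eq_one_of_half_lt_minMass (hP : IsMarkovChain P) (hπ : IsStationary P π)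
    (h : 1 / 2 < minMass π) (x : K) : π x = 1 := by
  by_contra hx
  have hm : mass π {x} = π x := by simp [mass]
  have hne : ({x} : Finset K) ≠ Finset.univ := by
    intro hu
    rw [hu, mass_univ hπ] at hm
    exact hx hm.symm
  obtain ⟨y, hy⟩ : ∃ y, y ∉ ({x} : Finset K) := by
    by_contra! hall
    exact hne (Finset.eq_univ_iff_forall.2 hall)
  have h1 : π y ≤ mass π ({x} : Finset K)ᶜ :=
    Finset.single_le_sum (fun z _ => (hπ.pos hP z).le) (Finset.mem_compl.2 hy)
  rw [mass_compl hπ, hm] at h1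
  linarith [minMass_le hπ x, minMass_le hπ y]

theorem Continuization.spreadProfile_of_lt (C : Continuization π) (hP : IsMarkovChain P)
    (hπ : IsStationary P π) {x : ℝ} (hx : x < minMass π) : C.spreadProfile P x = 0 := by
  have : {r | ∃ A : Finset K, A.Nonempty ∧ mass π A ≤ x ∧ r = C.spread P A} = ∅ := by
    rw [Set.eq_empty_iff_forall_notMem]
    rintro _ ⟨A, ⟨v, hv⟩, hA, -⟩
    have := Finset.single_le_sum (f := π) (fun z _ => (hπ.pos hP z).le) hv
    have h2 : π v ≤ mass π A := this
    linarith [minMass_le hπ v]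
  rw [spreadProfile, this, Real.sInf_empty]

/-! ### The logarithmic bound. -/

theorem evoExp_succ_le (C : Continuization π) (hP : IsMarkovChain P) (hlazy : IsLazy P)
    (hπ : IsStationary P π) (h0 : minMass π ≤ 1 / 2) (A : Finset K) (n : ℕ) :
    evoExp P π A (n + 1) (spreadNorm π) ≤
      (1 - C.spreadProfile P (1 / 2) / 4) * evoExp P π A n (spreadNorm π) := by
  rw [evoExp_succ, ← evoExp_const_mul]
  refine evoExp_mono A n fun S => ?_
  rcases S.eq_empty_or_nonempty with rfl | ⟨v, hv⟩
  · rw [integral_spreadNorm_empty]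
    simp [spreadNorm, mass]
  refine (C.integral_spreadNorm_le_profile hP hlazy hπ S).trans
    (mul_le_mul_of_nonneg_right ?_ (Real.sqrt_nonneg _))
  have hm : minMass π ≤ mass π S := (minMass_le hπ v).trans
    (Finset.single_le_sum (f := π) (fun z _ => (hπ.pos hP z).le) hv)
  linarith [C.spreadProfile_anti hP hlazy hπ (le_min hm h0) (min_le_right (mass π S) (1 / 2))]

theorem evoExp_spreadNorm_nonneg (A : Finset K) (n : ℕ) :
    0 ≤ evoExp P π A n (spreadNorm π) :=
  Finset.sum_nonneg fun S _ => mul_nonneg (evolve_pow_nonneg n A S) (Real.sqrt_nonneg _)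

theorem evoExp_add_le (C : Continuization π) (hP : IsMarkovChain P) (hlazy : IsLazy P)
    (hπ : IsStationary P π) (h0 : minMass π ≤ 1 / 2) (A : Finset K) (m n : ℕ) :
    evoExp P π A (m + n) (spreadNorm π) ≤
      Real.exp (-(C.spreadProfile P (1 / 2) / 4 * n)) * evoExp P π A m (spreadNorm π) := by
  induction n with
  | zero => simp
  | succ n ih =>
    have h1 := Real.add_one_le_exp (-(C.spreadProfile P (1 / 2) / 4))
    have hq := C.spreadProfile_le_quarter hP hlazy hπ h0
    rw [← add_assoc]
    refine (evoExp_succ_le C hP hlazy hπ h0 A (m + n)).trans ?_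
    calc _ ≤ Real.exp (-(C.spreadProfile P (1 / 2) / 4)) *
          (Real.exp (-(C.spreadProfile P (1 / 2) / 4 * n)) * evoExp P π A m (spreadNorm π)) :=
        mul_le_mul (by linarith) ih (evoExp_spreadNorm_nonneg A _) (Real.exp_pos _).le
      _ = _ := by
        rw [← mul_assoc, ← Real.exp_add]
        congr 2
        push_cast
        ring

theorem evoExp_one_le (C : Continuization π) (hP : IsMarkovChain P) (hlazy : IsLazy P)
    (hπ : IsStationary P π) {x : K} (hx : π x ≤ 1 / 2) :
    evoExp P π {x} 1 (spreadNorm π) ≤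
      Real.exp (-C.spreadProfile P (1 / 2)) * √(π x * (1 - π x)) := by
  have h := C.integral_spreadNorm_singleton_le hP hlazy hπ hx
  have e := evoExp_succ (P := P) (π := π) {x} 0 (spreadNorm π)
  rw [zero_add, evoExp_zero] at e
  rw [e, ← spreadNorm_singleton x]
  refine h.trans (mul_le_mul_of_nonneg_right ?_ (Real.sqrt_nonneg _))
  linarith [Real.add_one_le_exp (-C.spreadProfile P (1 / 2))]

theorem minMass_pos (hP : IsMarkovChain P) (hπ : IsStationary P π) : 0 < minMass π := by
  obtain ⟨v, hv⟩ := exists_eq_minMass hπ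
  exact hv ▸ hπ.pos hP v

theorem Continuization.evoExp_le_of_log (C : Continuization π) (hP : IsMarkovChain P)
    (hlazy : IsLazy P) (hπ : IsStationary P π) (h0 : minMass π ≤ 1 / 2) {ε : ℝ} (hε : 0 < ε)
    (hε1 : ε < 1) (x : K) {n : ℕ}
    (hn : 2 / C.spreadProfile P (1 / 2) *
      (Real.log (1 / minMass π) + 2 * Real.log (1 / (2 * ε))) < n + 1) :
    evoExp P π {x} n (spreadNorm π) ≤ 2 * ε * π x := by
  have hm := minMass_pos hP hπ
  have hx := hπ.pos hP x
  have hmx := minMass_le hπ x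
  have hx1 : π x ≤ 1 := by simpa [mass] using mass_le_one hπ {x}
  have hq := C.spreadProfile_le_quarter hP hlazy hπ h0
  have hq0 := C.spreadProfile_pos hP hlazy hπ h0 (by norm_num)
  set q := C.spreadProfile P (1 / 2) with hqdef
  have hexp : Real.exp (-((Real.log (1 / minMass π) + 2 * Real.log (1 / (2 * ε))) / 2)) =
      2 * ε * √(minMass π) := by
    rw [one_div, one_div, Real.log_inv, Real.log_inv,
      show -((-Real.log (minMass π) + 2 * -Real.log (2 * ε)) / 2) =
        Real.log (2 * ε) + 1 / 2 * Real.log (minMass π) by ring, Real.exp_add,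
      Real.exp_log (by positivity), mul_comm (1 / 2 : ℝ), Real.exp_mul, Real.exp_log hm,
      Real.sqrt_eq_rpow]
  set L := Real.log (1 / minMass π) + 2 * Real.log (1 / (2 * ε)) with hL
  have hLn : L / 2 < q / 4 * (n + 1) := by
    rw [div_mul_eq_mul_div, div_lt_iff₀ hq0] at hn
    linarith
  have hsm : √(minMass π) ^ 2 = minMass π := Real.sq_sqrt hm.le
  have hsm0 : 0 ≤ √(minMass π) := Real.sqrt_nonneg _
  have hnorm : √(π x * (1 - π x)) ≤ 1 / 2 := by
    rw [Real.sqrt_le_left (by norm_num)]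
    nlinarith [sq_nonneg (π x - 1 / 2)]
  rcases n.eq_zero_or_pos with rfl | hn1
  -- No step is taken: `L/2 < q/4 ≤ 1/16` forces `2ε√π₀ ≥ 15/16`, and the starting norm already
  -- meets the target.
  · rw [evoExp_zero, spreadNorm_singleton, Real.sqrt_le_left (by positivity)]
    have h1 : 15 / 16 ≤ 2 * ε * √(minMass π) := by
      rw [← hexp]
      refine le_trans ?_ (Real.add_one_le_exp _)
      push_cast at hLn
      linarith
    have h2 : (15 / 16 : ℝ) ^ 2 ≤ 4 * ε ^ 2 * minMass π := by
      calc (15 / 16 : ℝ) ^ 2 ≤ (2 * ε * √(minMass π)) ^ 2 := by gcongr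
        _ = _ := by rw [mul_pow, hsm]; ring
    have h3 : ε ^ 2 ≤ 1 := by nlinarith
    have h4 : 4 * ε ^ 2 * minMass π ≤ 4 * minMass π := by nlinarith
    have h5 : 1 - π x ≤ 4 * ε ^ 2 * π x := by
      have : 4 * ε ^ 2 * minMass π ≤ 4 * ε ^ 2 * π x := by gcongr
      norm_num at h2
      linarith
    calc π x * (1 - π x) ≤ π x * (4 * ε ^ 2 * π x) := by gcongr
      _ = _ := by ring
  obtain ⟨m, rfl⟩ : ∃ m, n = 1 + m := ⟨n - 1, by omega⟩
  push_cast at hLn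
  rcases le_or_gt (π x) (1 / 2) with hx2 | hx2
  -- The first step contracts at rate `q` instead of `q/4`, so the exponent `q + qm/4` exceeds `q(m
  -- + 2)/4 > L/2`.
  · calc _ ≤ Real.exp (-(q / 4 * m)) * (Real.exp (-q) * √(π x * (1 - π x))) :=
          (evoExp_add_le C hP hlazy hπ h0 {x} 1 m).trans
            (mul_le_mul_of_nonneg_left (evoExp_one_le C hP hlazy hπ hx2) (Real.exp_pos _).le)
      _ ≤ Real.exp (-(L / 2)) * √(π x) := by
          rw [← mul_assoc, ← Real.exp_add]
          refine mul_le_mul (Real.exp_le_exp.2 (by linarith)) (Real.sqrt_le_sqrt ?_)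
            (Real.sqrt_nonneg _) (Real.exp_pos _).le
          nlinarith
      _ ≤ 2 * ε * √(π x) * √(π x) := by
          rw [hexp]
          have := Real.sqrt_le_sqrt hmx
          gcongr
      _ = 2 * ε * π x := by rw [mul_assoc, Real.mul_self_sqrt hx.le]
  -- For `π x > 1/2` the singleton rate is not available. The missing factor is at most `exp
  -- (1/16)`, which the crude bounds on the norm and on `√π₀` absorb.
  · have h1 : Real.exp (1 / 16) ≤ 16 / 15 := by
      have h := Real.add_one_le_exp (-(1 / 16 : ℝ))
      rw [Real.exp_neg] at h
      have h2 : (15 / 16 : ℝ) ≤ (Real.exp (1 / 16))⁻¹ := by linarith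
      rw [le_inv_comm₀ (by norm_num) (Real.exp_pos _)] at h2
      linarith
    have h2 : √(minMass π) ≤ 3 / 4 := by
      rw [Real.sqrt_le_left (by norm_num)]
      linarith
    have h3 := evoExp_add_le C hP hlazy hπ h0 {x} 0 (1 + m)
    rw [zero_add, evoExp_zero, spreadNorm_singleton] at h3
    push_cast at h3
    calc _ ≤ _ := h3
      _ ≤ Real.exp (1 / 16 + -(L / 2)) * (1 / 2) :=
        mul_le_mul (Real.exp_le_exp.2 (by linarith)) hnorm (Real.sqrt_nonneg _)
          (Real.exp_pos _).le
      _ = Real.exp (1 / 16) * (2 * ε * √(minMass π)) * (1 / 2) := by rw [Real.exp_add, hexp]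
      _ ≤ 16 / 15 * (2 * ε * (3 / 4)) * (1 / 2) := by gcongr
      _ ≤ 2 * ε * π x := by nlinarith

/-! ### The integral bound. -/

/-- The integrand of the mixing bound, continued past one half. -/
noncomputable def Continuization.rate (C : Continuization π) (P : Matrix K K ℝ) (x : ℝ) : ℝ :=
  4 * (1 / (x * C.spreadProfile P (min x (1 / 2))))

theorem Continuization.intervalIntegrable_rate (C : Continuization π) (hP : IsMarkovChain P)
    (hlazy : IsLazy P) (hπ : IsStationary P π) (h0 : minMass π ≤ 1 / 2) {s t : ℝ}
    (hs : minMass π ≤ s) (hst : s ≤ t) : IntervalIntegrable (C.rate P) volume s t := by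
  have hm := minMass_pos hP hπ
  have h1 : MonotoneOn (fun x => 1 / C.spreadProfile P (min x (1 / 2))) (Set.uIcc s t) := by
    intro x hx y hy hxy
    rw [Set.uIcc_of_le hst] at hx hy
    refine one_div_le_one_div_of_le (C.spreadProfile_pos hP hlazy hπ
      (le_min (hs.trans hy.1) h0) ((min_le_right _ _).trans_lt (by norm_num))) ?_
    exact C.spreadProfile_anti hP hlazy hπ (le_min (hs.trans hx.1) h0)
      (min_le_min_right _ hxy)
  have h2 : ContinuousOn (fun x : ℝ => 4 * (1 / x)) (Set.uIcc s t) := by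
    refine ContinuousOn.mul continuousOn_const
      (ContinuousOn.div continuousOn_const continuousOn_id fun x hx => ?_)
    rw [Set.uIcc_of_le hst] at hx
    exact (hm.trans_le (hs.trans hx.1)).ne'
  refine (h1.intervalIntegrable.mul_continuousOn h2).congr fun x _ => ?_
  simp only [rate, one_div, mul_inv]
  ring

theorem Continuization.rate_nonneg (C : Continuization π) (hP : IsMarkovChain P)
    (hlazy : IsLazy P) (hπ : IsStationary P π) (h0 : minMass π ≤ 1 / 2) {x : ℝ}
    (hx : minMass π ≤ x) : 0 ≤ C.rate P x := by
  have h1 := (minMass_pos hP hπ).trans_le hx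
  have h2 := C.spreadProfile_pos hP hlazy hπ (le_min hx h0)
    ((min_le_right _ _).trans_lt (by norm_num))
  rw [rate]
  positivity

/-- The profile decreases, so the rate on `[s,t]` is at least `4/(qx)` with `q` its value at `s`,
and `∫ 4/(qx)` from `s` to `s exp(q/4)` is one. -/
theorem Continuization.one_le_integral_rate (C : Continuization π) (hP : IsMarkovChain P)
    (hlazy : IsLazy P) (hπ : IsStationary P π) (h0 : minMass π ≤ 1 / 2) {s t : ℝ}
    (hs : minMass π ≤ s)
    (ht : s * Real.exp (C.spreadProfile P (min s (1 / 2)) / 4) ≤ t) :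
    1 ≤ ∫ x in s..t, C.rate P x := by
  have hs0 := (minMass_pos hP hπ).trans_le hs
  have hq : ∀ x, s ≤ x → 0 < C.spreadProfile P (min x (1 / 2)) := fun x hx =>
    C.spreadProfile_pos hP hlazy hπ (le_min (hs.trans hx) h0)
      ((min_le_right _ _).trans_lt (by norm_num))
  set q := C.spreadProfile P (min s (1 / 2)) with hqdef
  have hq0 : 0 < q := hq s le_rfl
  have hst : s ≤ t := le_trans (le_mul_of_one_le_right hs0.le
    (Real.one_le_exp (by positivity))) ht
  have ht0 : 0 < t := hs0.trans_le hst
  have h1 : ∫ x in s..t, 4 / q * x⁻¹ ≤ ∫ x in s..t, C.rate P x := by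
    refine intervalIntegral.integral_mono_on hst ?_
      (C.intervalIntegrable_rate hP hlazy hπ h0 hs hst) fun x hx => ?_
    · refine (intervalIntegral.intervalIntegrable_inv (fun x hx => ?_) continuousOn_id).const_mul _
      rw [Set.uIcc_of_le hst] at hx
      exact (hs0.trans_le hx.1).ne'
    · have hx0 : 0 < x := hs0.trans_le hx.1
      have hqx := hq x hx.1
      have : C.spreadProfile P (min x (1 / 2)) ≤ q :=
        C.spreadProfile_anti hP hlazy hπ (le_min hs h0) (min_le_min_right _ hx.1)
      have e : 4 / q * x⁻¹ = 4 * (1 / (x * q)) := by field_simp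
      rw [e, rate]
      gcongr
  refine le_trans ?_ h1
  rw [intervalIntegral.integral_const_mul, integral_inv_of_pos hs0 ht0]
  have h2 : q / 4 ≤ Real.log (t / s) := by
    rw [Real.le_log_iff_exp_le (by positivity), le_div_iff₀ hs0]
    linarith
  calc (1 : ℝ) = 4 / q * (q / 4) := by field_simp
    _ ≤ _ := mul_le_mul_of_nonneg_left h2 (by positivity)

theorem Continuization.integral_rate_eq (C : Continuization π) (hP : IsMarkovChain P)
    (hlazy : IsLazy P) (hπ : IsStationary P π) (h0 : minMass π ≤ 1 / 2) {t : ℝ}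
    (ht : 1 / 2 ≤ t) :
    ∫ x in minMass π..t, C.rate P x =
      4 * (∫ x in minMass π..1 / 2, 1 / (x * C.spreadProfile P x)) +
        4 * Real.log (2 * t) / C.spreadProfile P (1 / 2) := by
  rw [← intervalIntegral.integral_add_adjacent_intervals
    (C.intervalIntegrable_rate hP hlazy hπ h0 le_rfl h0)
    (C.intervalIntegrable_rate hP hlazy hπ h0 h0 ht), ← intervalIntegral.integral_const_mul]
  congr 1
  · refine intervalIntegral.integral_congr fun x hx => ?_
    rw [Set.uIcc_of_le h0] at hx
    simp only [rate, min_eq_left hx.2]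
  · have h1 : ∫ x in (1 / 2 : ℝ)..t, C.rate P x =
        ∫ x in (1 / 2 : ℝ)..t, 4 / C.spreadProfile P (1 / 2) * x⁻¹ := by
      refine intervalIntegral.integral_congr fun x hx => ?_
      rw [Set.uIcc_of_le ht] at hx
      rw [rate, min_eq_right hx.1, one_div, mul_inv]
      ring
    rw [h1, intervalIntegral.integral_const_mul, integral_inv_of_pos (by norm_num) (by linarith),
      show t / (1 / 2) = 2 * t by ring]
    ring

/-- One step of the evolving set process contracts at the rate belonging to four times the
inverse square of the current normalised expectation. -/
theorem Continuization.evoExp_succ_le_profile (C : Continuization π) (hP : IsMarkovChain P)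
    (hlazy : IsLazy P) (hπ : IsStationary P π) (h0 : minMass π ≤ 1 / 2) (A : Finset K) (n : ℕ)
    {l : ℝ} (hl : 0 < l) (hln : evoExp P π A n (spreadNorm π) = l * mass π A)
    (hv : minMass π ≤ 4 / l ^ 2) :
    evoExp P π A (n + 1) (spreadNorm π) ≤
      (1 - C.spreadProfile P (min (4 / l ^ 2) (1 / 2)) / 8) * (l * mass π A) := by
  set ψ := C.spreadProfile P (min (4 / l ^ 2) (1 / 2)) with hψ
  have hψ0 : 0 < ψ := C.spreadProfile_pos hP hlazy hπ (le_min hv h0)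
    ((min_le_right _ _).trans_lt (by norm_num))
  rw [evoExp_succ]
  -- If the norm of `S` is at most `(l/2) π(S)`, the added mass term outweighs the claimed
  -- contraction; otherwise `π(S) < 4/l²` and the rate `ψ/4` applies. As the mean mass is fixed, the
  -- added term costs exactly half of the rate.
  have hpt : ∀ S : Finset K, ∫ u in (0 : ℝ)..1, spreadNorm π (levelSet P π S u) ≤
      (1 - ψ / 4) * spreadNorm π S - -(ψ * l / 8) * mass π S := by
    intro S
    have hF : 0 ≤ spreadNorm π S := Real.sqrt_nonneg _
    have hmS := mass_nonneg hπ S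
    rcases S.eq_empty_or_nonempty with rfl | ⟨v, hvS⟩
    · rw [integral_spreadNorm_empty]
      simp [spreadNorm, mass]
    have hm : minMass π ≤ mass π S := (minMass_le hπ v).trans
      (Finset.single_le_sum (f := π) (fun z _ => (hπ.pos hP z).le) hvS)
    have hm0 : 0 < mass π S := (minMass_pos hP hπ).trans_le hm
    have h := C.integral_spreadNorm_le_profile hP hlazy hπ S
    rcases le_or_gt (spreadNorm π S) (l / 2 * mass π S) with h1 | h1
    · have h2 : 0 < C.spreadProfile P (min (mass π S) (1 / 2)) :=
        C.spreadProfile_pos hP hlazy hπ (le_min hm h0)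
          ((min_le_right _ _).trans_lt (by norm_num))
      nlinarith
    · have h2 : (l / 2 * mass π S) ^ 2 < mass π S * (1 - mass π S) := by
        rw [spreadNorm] at h1
        exact (Real.lt_sqrt (by positivity)).1 h1
      have h3 : mass π S ≤ 4 / l ^ 2 := by
        rw [le_div_iff₀ (by positivity)]
        have h4 : mass π S * (mass π S * l ^ 2) < mass π S * 4 := by nlinarith
        exact (lt_of_mul_lt_mul_left h4 hm0.le).le
      have h4 : ψ ≤ C.spreadProfile P (min (mass π S) (1 / 2)) :=
        C.spreadProfile_anti hP hlazy hπ (le_min hm h0) (min_le_min_right _ h3)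
      have h5 : 0 ≤ ψ * l / 8 * mass π S := by positivity
      nlinarith
  refine (evoExp_mono A n hpt).trans (le_of_eq ?_)
  rw [evoExp_sub, evoExp_const_mul, evoExp_const_mul, evoExp_mass hP hπ, hln]
  ring

theorem Continuization.evoExp_le_of_integral (C : Continuization π) (hP : IsMarkovChain P)
    (hlazy : IsLazy P) (hπ : IsStationary P π) (h0 : minMass π ≤ 1 / 2) {ε : ℝ} (hε : 0 < ε)
    (x : K) {n : ℕ} (hn : ∫ x in minMass π..1 / ε ^ 2, C.rate P x < n + 1) :
    evoExp P π {x} n (spreadNorm π) ≤ 2 * ε * π x := by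
  by_contra! hcon
  have hm := minMass_pos hP hπ
  have hx := hπ.pos hP x
  have hmx := minMass_le hπ x
  have hmass : mass π {x} = π x := by simp [mass]
  have hq0 := C.spreadProfile_pos hP hlazy hπ h0 (by norm_num)
  let l : ℕ → ℝ := fun k => evoExp P π {x} k (spreadNorm π) / π x
  have hlmul : ∀ k, evoExp P π {x} k (spreadNorm π) = l k * mass π {x} := fun k => by
    rw [hmass]
    exact (div_mul_cancel₀ _ hx.ne').symm
  have hanti : Antitone l := antitone_nat_of_succ_le fun k => by
    refine div_le_div_of_nonneg_right ((evoExp_succ_le C hP hlazy hπ h0 {x} k).trans ?_) hx.le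
    exact mul_le_of_le_one_left (evoExp_spreadNorm_nonneg _ _) (by linarith)
  have hln : 2 * ε < l n := (lt_div_iff₀ hx).2 hcon
  have hlpos : ∀ k ≤ n, 0 < l k := fun k hk =>
    lt_of_lt_of_le (by linarith) (hln.le.trans (hanti hk))
  let v : ℕ → ℝ := fun k => 4 / l k ^ 2
  have hvmono : ∀ j k, j ≤ k → k ≤ n → v j ≤ v k := fun j k hjk hk => by
    have h1 := hlpos k hk
    have h2 := hanti hjk
    simp only [v]
    gcongr
  have hv0 : 4 * minMass π ≤ v 0 := by
    have hl0 : l 0 ^ 2 * π x ≤ 1 := by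
      simp only [l]
      rw [evoExp_zero, spreadNorm_singleton, div_pow, Real.sq_sqrt]
      · rw [div_mul_eq_mul_div, div_le_one (by positivity)]
        nlinarith [sq_nonneg (π x)]
      · have : mass π {x} ≤ 1 := mass_le_one hπ {x}
        rw [hmass] at this
        exact mul_nonneg hx.le (by linarith)
    have h1 := hlpos 0 n.zero_le
    simp only [v]
    rw [le_div_iff₀ (by positivity)]
    nlinarith [sq_nonneg (l 0)]
  have hvm : ∀ k ≤ n, minMass π ≤ v k := fun k hk => by
    linarith [hvmono 0 k k.zero_le hk]
  have hvn : v n ≤ 1 / ε ^ 2 := by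
    have h1 : (2 * ε) ^ 2 ≤ l n ^ 2 := by gcongr
    have h2 : 4 / l n ^ 2 ≤ 4 / (2 * ε) ^ 2 := by gcongr
    refine h2.trans (le_of_eq ?_)
    field_simp
    norm_num
  have hint : ∀ s t, minMass π ≤ s → s ≤ t → IntervalIntegrable (C.rate P) volume s t :=
    fun s t => C.intervalIntegrable_rate hP hlazy hπ h0
  have hstep : ∀ k, k + 1 ≤ n → 1 ≤ ∫ x in v k..v (k + 1), C.rate P x := by
    intro k hk
    have hk' : k ≤ n := by omega
    refine C.one_le_integral_rate hP hlazy hπ h0 (hvm k hk') ?_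
    have hlk := hlpos k hk'
    have hlk1 := hlpos (k + 1) hk
    have h1 := C.evoExp_succ_le_profile hP hlazy hπ h0 {x} k hlk (hlmul k) (hvm k hk')
    set ψ := C.spreadProfile P (min (4 / l k ^ 2) (1 / 2)) with hψ
    rw [hlmul (k + 1), hmass, ← mul_assoc] at h1
    have h2 : l (k + 1) ≤ (1 - ψ / 8) * l k := le_of_mul_le_mul_right h1 hx
    have h3 : l (k + 1) ≤ Real.exp (-(ψ / 8)) * l k := h2.trans
      (mul_le_mul_of_nonneg_right (by linarith [Real.add_one_le_exp (-(ψ / 8))]) hlk.le)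
    have h4 : l (k + 1) ^ 2 * Real.exp (ψ / 4) ≤ l k ^ 2 := by
      calc _ ≤ (Real.exp (-(ψ / 8)) * l k) ^ 2 * Real.exp (ψ / 4) := by gcongr
        _ = Real.exp (-(ψ / 8) + -(ψ / 8) + ψ / 4) * l k ^ 2 := by
          rw [Real.exp_add, Real.exp_add]
          ring
        _ = l k ^ 2 := by
          rw [show -(ψ / 8) + -(ψ / 8) + ψ / 4 = 0 by ring, Real.exp_zero, one_mul]
    change 4 / l k ^ 2 * Real.exp (ψ / 4) ≤ 4 / l (k + 1) ^ 2
    rw [div_mul_eq_mul_div, div_le_div_iff₀ (by positivity) (by positivity)]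
    linarith
  have hsum : ∀ k ≤ n, (k : ℝ) ≤ ∫ x in v 0..v k, C.rate P x := by
    intro k
    induction k with
    | zero => simp
    | succ k ih =>
      intro hk
      rw [← intervalIntegral.integral_add_adjacent_intervals
        (hint _ _ (hvm 0 n.zero_le) (hvmono 0 k k.zero_le (by omega)))
        (hint _ _ (hvm k (by omega)) (hvmono k (k + 1) k.le_succ hk))]
      push_cast
      exact add_le_add (ih (by omega)) (hstep k hk)
  -- The stretch from `π₀` to `v 0 ≥ 4π₀` contributes a unit before any step is made; this makes up
  -- for the floor.
  have hstart : 1 ≤ ∫ x in minMass π..v 0, C.rate P x := by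
    refine C.one_le_integral_rate hP hlazy hπ h0 le_rfl (le_trans ?_ hv0)
    rw [mul_comm]
    refine mul_le_mul_of_nonneg_right ?_ hm.le
    have h1 := C.spreadProfile_le_quarter hP hlazy hπ (x := min (minMass π) (1 / 2))
      (le_min le_rfl h0)
    calc Real.exp (C.spreadProfile P (min (minMass π) (1 / 2)) / 4) ≤ Real.exp 1 :=
          Real.exp_le_exp.2 (by linarith)
      _ ≤ 4 := by linarith [Real.exp_one_lt_d9]
  have hend : 0 ≤ ∫ x in v n..1 / ε ^ 2, C.rate P x :=
    intervalIntegral.integral_nonneg hvn fun y hy =>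
      C.rate_nonneg hP hlazy hπ h0 ((hvm n le_rfl).trans hy.1)
  have i1 := hint _ _ le_rfl (hvm 0 n.zero_le)
  have i2 := hint _ _ (hvm 0 n.zero_le) (hvmono 0 n n.zero_le le_rfl)
  have i3 := hint _ _ (hvm n le_rfl) hvn
  rw [← intervalIntegral.integral_add_adjacent_intervals (i1.trans i2) i3,
    ← intervalIntegral.integral_add_adjacent_intervals i1 i2] at hn
  linarith [hsum n le_rfl]

theorem Continuization.integral_profile_of_half_lt (C : Continuization π) (hP : IsMarkovChain P)
    (hπ : IsStationary P π) (h : 1 / 2 < minMass π) :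
    ∫ x in minMass π..1 / 2, 1 / (x * C.spreadProfile P x) = 0 := by
  rw [intervalIntegral.integral_symm, intervalIntegral.integral_of_le h.le,
    integral_Ioc_eq_integral_Ioo, setIntegral_congr_fun (g := fun _ => (0 : ℝ)) measurableSet_Ioo]
  · simp
  · intro x hx
    simp [C.spreadProfile_of_lt hP hπ hx.2]

end

end Spread

theorem mainTheorem1 {K : Type*} [Fintype K] [DecidableEq K]
    (P : Matrix K K ℝ) (π : K → ℝ) (C : Spread.Continuization π)
    (hP : Spread.IsMarkovChain P) (hlazy : Spread.IsLazy P) (hπ : Spread.IsStationary P π) :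
    (∀ A : Finset K, A.Nonempty → Spread.mass π A ≤ 1 / 2 →
      1 / 2 * C.modSpread P A ≤ C.glSpread P A ∧
      Spread.evoSpread P π A ≤ 1 / 2 * C.modSpread P A ∧
      1 / 4 * C.spread P A ≤ Spread.evoSpread P π A) ∧
    (∀ ε : ℝ, 0 < ε → ε < 1 →
      Spread.tvMixingTime P π ε ≤ Spread.chiSqMixingTime P π (4 * ε ^ 2) ∧
      (((Spread.chiSqMixingTime P π (4 * ε ^ 2) : ℕ∞) : ℝ≥0∞) : EReal) ≤
        ((4 * (∫ x in Spread.minMass π..1 / 2, 1 / (x * C.spreadProfile P x)) +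
          4 * Real.log (2 / ε ^ 2) / C.spreadProfile P (1 / 2) : ℝ) : EReal) ∧
      (4 * ε ^ 2 * Spread.minMass π ≤ 1 →
        (((Spread.chiSqMixingTime P π (4 * ε ^ 2) : ℕ∞) : ℝ≥0∞) : EReal) ≤
          ((2 / C.spreadProfile P (1 / 2) *
            (Real.log (1 / Spread.minMass π) + 2 * Real.log (1 / (2 * ε))) : ℝ) : EReal))) := by
  refine ⟨fun A hA hA2 => ⟨C.half_modSpread_le_glSpread hP hlazy hπ hA hA2,
    C.evoSpread_le_half_modSpread hP hlazy hπ hA hA2,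
    C.quarter_spread_le_evoSpread hP hlazy hπ hA⟩, fun ε hε hε1 =>
    ⟨Spread.tvMixingTime_le_chiSqMixingTime hπ.mem_stdSimplex hε, ?_⟩⟩
  have hm := Spread.minMass_pos hP hπ
  rcases lt_or_ge (1 / 2) (Spread.minMass π) with h0 | h0
  -- Here every state has mass one. The profile below `π₀` is an infimum over the empty set, hence
  -- zero, and division by zero makes both right-hand sides zero.
  · have hzero : ∀ x, Spread.evoExp P π {x} ⌊(0 : ℝ)⌋₊ (Spread.spreadNorm π) ≤ 2 * ε * π x := by
      intro x
      rw [Nat.floor_zero, Spread.evoExp_zero, Spread.spreadNorm_singleton,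
        Spread.eq_one_of_half_lt_minMass hP hπ h0 x]
      simp [hε.le]
    have hle := Spread.coe_chiSqMixingTime_le hP hπ le_rfl hzero
    rw [C.integral_profile_of_half_lt hP hπ h0, C.spreadProfile_of_lt hP hπ h0]
    simp only [div_zero, mul_zero, zero_mul, add_zero]
    exact ⟨hle, fun _ => hle⟩
  · have hq0 := C.spreadProfile_pos hP hlazy hπ h0 (by norm_num)
    have hε2 : ε ^ 2 ≤ 1 := by nlinarith
    have ht : 1 ≤ 1 / ε ^ 2 := (one_le_div (by positivity)).2 hε2
    refine ⟨?_, fun h1 => ?_⟩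
    · have e := C.integral_rate_eq hP hlazy hπ h0 (t := 1 / ε ^ 2) (by linarith)
      rw [mul_one_div] at e
      rw [← e]
      refine Spread.coe_chiSqMixingTime_le hP hπ ?_ fun x =>
        C.evoExp_le_of_integral hP hlazy hπ h0 hε x (Nat.lt_floor_add_one _)
      exact intervalIntegral.integral_nonneg (by linarith) fun y hy =>
        C.rate_nonneg hP hlazy hπ h0 hy.1
    · refine Spread.coe_chiSqMixingTime_le hP hπ (mul_nonneg (by positivity) ?_) fun x =>
        C.evoExp_le_of_log hP hlazy hπ h0 hε hε1 x (Nat.lt_floor_add_one _)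
      -- The extra hypothesis says precisely that the logarithmic bound is nonnegative.
      have h2 : 0 ≤ -Real.log (4 * ε ^ 2 * Spread.minMass π) :=
        neg_nonneg.2 (Real.log_nonpos (by positivity) h1)
      rw [show 4 * ε ^ 2 * Spread.minMass π = (2 * ε) ^ 2 * Spread.minMass π by ring,
        Real.log_mul (by positivity) hm.ne', Real.log_pow] at h2
      rw [one_div, one_div, Real.log_inv, Real.log_inv]
      push_cast at h2
      linarith
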